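/- Let $(A,\Delta)$ be a multiplier Hopf $^*$-algebra: a complex $^*$-algebra $A$, possibly without identity, with non-degenerate product, and a coassociative non-degenerate $^*$-homomorphism $\Delta:A\to M(A\otimes A)$ such that $a\otimes a'\mapsto\Delta(a)(1\otimes a')$ and $a\otimes a'\mapsto(a\otimes 1)\Delta(a')$ are bijections of $A\otimes A$ onto itself. Let $\varphi$ be a positive left integral on $A$, that is, a non-zero linear functional with $\varphi(a^*a)\ge 0$ and $(\iota\otimes\varphi)\Delta(a)=\varphi(a)1$ for all $a\in A$. Let $B=\{\varphi(\,\cdot\,a): a\in A\}$ be the dual algebra, write $\langle a,b\rangle=b(a)$, and let the product of $B$ be dual to $\Delta$, i.e. $\langle a,bb'\rangle=\langle a_{(1)},b\rangle\langle a_{(2)},b'\rangle$. Then the map $F:A\to B$, $F(a)=\varphi(\,\cdot\,a)$, is bijective; $A$ has a unique bijective antipode $S$; and there is a unique homomorphism $\Delta_B:B\to M(B\otimes B)$ that is the opposite of the coproduct dual to the product of $A$, i.e. $\langle a\otimes a',\Delta_B(b)\rangle=\langle a'a,b\rangle$ (for the extended pairing of $A\otimes A$ with $M(B\otimes B)$).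 The Sweedler notation below refers to $\Delta$ on $A$ and $\Delta_B$ on $B$. Let $W=V^{-1}$, where $V:A\otimes A\to A\otimes A$ is the bijection $V(x\otimes x')=\Delta(x')(x\otimes 1)$. Then $U=(F\otimes\iota)W(F\otimes\iota)^{-1}$ is the well-defined map $$U:\ y\otimes x\mapsto\langle S^{-1}(x_{(1)}),y_{(1)}\rangle\,y_{(2)}\otimes x_{(2)}$$ from $B\otimes A$ to itself, and its inverse is the well-defined map $$U^{-1}:\ y\otimes x\mapsto\langle x_{(1)},y_{(1)}\rangle\,y_{(2)}\otimes x_{(2)}$$ from $B\otimes A$ to itself. These two maps govern the Heisenberg commutation relations: for the operators $\pi(a)x=ax$ and $\lambda(b)x=\langle S^{-1}(x_{(1)}),b\rangle x_{(2)}$ on $A$ one has, for all $a\in A$ and $b\in B$, $$\pi(a)\lambda(b)=\langle a_{(1)},b_{(1)}\rangle\,\lambda(b_{(2)})\pi(a_{(2)}),\qquad \lambda(b)\pi(a)=\langle S^{-1}(a_{(1)}),b_{(1)}\rangle\,\pi(a_{(2)})\lambda(b_{(2)}),$$ that is, $\pi(a)\lambda(b)$ is the image of $U^{-1}(b\otimes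 a)$ under $b'\otimes a'\mapsto\lambda(b')\pi(a')$ and $\lambda(b)\pi(a)$ is the image of $U(b\otimes a)$ under $b'\otimes a'\mapsto\pi(a')\lambda(b')$. -/

import Mathlib

open scoped TensorProduct

/-! ## Multiplier algebras -/

section Multipliers

variable (A : Type*) [NonUnitalRing A] [Module ℂ A] [IsScalarTower ℂ A A] [SMulCommClass ℂ A A]

/-- The multiplier algebra `M(A)` of a complex algebra `A` (possibly without identity): pairs
`m = (L, R)` of linear maps, thought of as `L a = m a` and `R a = a m`, with the compatibility
`a (m b) = (a m) b` and the module properties. Multiplication is `(m n) a = m (n a)` and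
`a (m n) = (a m) n`, whence the opposite algebra in the second component. -/
def multiplierSubalgebra : Subalgebra ℂ (Module.End ℂ A × (Module.End ℂ A)ᵐᵒᵖ) where
  carrier := {m | (∀ a b, m.1 (a * b) = m.1 a * b) ∧
    (∀ a b, m.2.unop (a * b) = a * m.2.unop b) ∧ (∀ a b, a * m.1 b = m.2.unop a * b)}
  mul_mem' := by
    rintro m n ⟨h1, h2, h3⟩ ⟨k1, k2, k3⟩
    refine ⟨fun a b => ?_, fun a b => ?_, fun a b => ?_⟩ <;> simp_all
  add_mem' := by
    rintro m n ⟨h1, h2, h3⟩ ⟨k1, k2, k3⟩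
    refine ⟨fun a b => ?_, fun a b => ?_, fun a b => ?_⟩ <;> simp_all [add_mul, mul_add]
  algebraMap_mem' := by
    intro r
    refine ⟨fun a b => ?_, fun a b => ?_, fun a b => ?_⟩ <;>
      simp [Prod.algebraMap_apply, MulOpposite.algebraMap_apply, Module.algebraMap_end_apply,
        mul_smul_comm, smul_mul_assoc]

/-- The multiplier algebra `M(A)` as a type. -/
def MultiplierAlgebra : Type _ := multiplierSubalgebra A

instance : Ring (MultiplierAlgebra A) := inferInstanceAs (Ring (multiplierSubalgebra A))

instance : Algebra ℂ (MultiplierAlgebra A) :=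
  inferInstanceAs (Algebra ℂ (multiplierSubalgebra A))

namespace MultiplierAlgebra

variable {A}

/-- `m.left a` is the product `m a`. -/
def left (m : MultiplierAlgebra A) : A →ₗ[ℂ] A := m.1.1

/-- `m.right a` is the product `a m`. -/
def right (m : MultiplierAlgebra A) : A →ₗ[ℂ] A := m.1.2.unop

lemma left_mul (m : MultiplierAlgebra A) (a b : A) : m.left (a * b) = m.left a * b := m.2.1 a b

lemma right_mul (m : MultiplierAlgebra A) (a b : A) : m.right (a * b) = a * m.right b := m.2.2.1 a b

lemma mul_left (m : MultiplierAlgebra A) (a b : A) : a * m.left b = m.right a * b := m.2.2.2 a b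

lemma left_prod (m n : MultiplierAlgebra A) (a : A) : (m * n).left a = m.left (n.left a) := rfl

lemma right_prod (m n : MultiplierAlgebra A) (a : A) : (m * n).right a = n.right (m.right a) := rfl

/-- The canonical map `A → M(A)`, `a ↦ (x ↦ a x, x ↦ x a)`. -/
def of (a : A) : MultiplierAlgebra A :=
  ⟨(LinearMap.mulLeft ℂ a, MulOpposite.op (LinearMap.mulRight ℂ a)),
    fun x y => by simp [mul_assoc], fun x y => by simp [mul_assoc],
    fun x y => by simp [mul_assoc]⟩

lemma of_left (a x : A) : (of a).left x = a * x := rfl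

lemma of_right (a x : A) : (of a).right x = x * a := rfl

/-- The involution of `M(A)` when `A` is a `*`-algebra: `m* a = (a* m)*` and `a m* = (m a*)*`. -/
noncomputable instance [StarRing A] [StarModule ℂ A] : Star (MultiplierAlgebra A) where
  star m := ⟨(
      { toFun := fun a => star (m.right (star a))
        map_add' := fun a b => by simp
        map_smul' := fun r a => by simp },
      MulOpposite.op
      { toFun := fun a => star (m.left (star a))
        map_add' := fun a b => by simp
        map_smul' := fun r a => by simp }),
    fun a b => by simp [right_mul], fun a b => by simp [left_mul],
    fun a b => by
      change a * star (m.right (star b)) = star (m.left (star a)) * b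
      apply star_injective
      simpa using (m.mul_left (star b) (star a)).symm⟩

lemma star_left [StarRing A] [StarModule ℂ A] (m : MultiplierAlgebra A) (a : A) :
    (star m).left a = star (m.right (star a)) := rfl

lemma star_right [StarRing A] [StarModule ℂ A] (m : MultiplierAlgebra A) (a : A) :
    (star m).right a = star (m.left (star a)) := rfl

variable {B : Type*} [NonUnitalRing B] [Module ℂ B] [IsScalarTower ℂ B B] [SMulCommClass ℂ B B]

/-- The multiplier `m ⊗ n` of `A ⊗ B`. -/
noncomputable def tmul (m : MultiplierAlgebra A) (n : MultiplierAlgebra B) :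
    MultiplierAlgebra (A ⊗[ℂ] B) :=
  ⟨(TensorProduct.map m.left n.left, MulOpposite.op (TensorProduct.map m.right n.right)), by
    refine ⟨fun x y => ?_, fun x y => ?_, fun x y => ?_⟩ <;>
    · induction x using TensorProduct.induction_on with
      | zero => simp
      | add x₁ x₂ h₁ h₂ => simp_all [add_mul]
      | tmul a b =>
        induction y using TensorProduct.induction_on with
        | zero => simp
        | add y₁ y₂ h₁ h₂ => simp_all [mul_add]
        | tmul c d => simp [left_mul, right_mul, mul_left]⟩

/-- The multiplier `a ⊗ 1` of `A ⊗ B`. -/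
noncomputable def inl (a : A) : MultiplierAlgebra (A ⊗[ℂ] B) := tmul (of a) 1

/-- The multiplier `1 ⊗ b` of `A ⊗ B`. -/
noncomputable def inr (b : B) : MultiplierAlgebra (A ⊗[ℂ] B) := tmul 1 (of b)

lemma inl_left (a x : A) (y : B) : (inl a).left (x ⊗ₜ[ℂ] y) = (a * x) ⊗ₜ[ℂ] y := rfl

lemma inl_right (a x : A) (y : B) : (inl a).right (x ⊗ₜ[ℂ] y) = (x * a) ⊗ₜ[ℂ] y := rfl

lemma inr_left (b : B) (x : A) (y : B) : (inr b).left (x ⊗ₜ[ℂ] y) = x ⊗ₜ[ℂ] (b * y) := rfl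

lemma inr_right (b : B) (x : A) (y : B) : (inr b).right (x ⊗ₜ[ℂ] y) = x ⊗ₜ[ℂ] (y * b) := rfl

lemma rid_inl (g : A →ₗ[ℂ] ℂ) (a : A) (t : A ⊗[ℂ] A) :
    TensorProduct.rid ℂ A (LinearMap.lTensor A g ((inl a).left t)) =
      a * TensorProduct.rid ℂ A (LinearMap.lTensor A g t) := by
  induction t using TensorProduct.induction_on with
  | zero => simp
  | add w₁ w₂ h₁ h₂ => simp only [map_add, h₁, h₂, mul_add]
  | tmul y y' => simp [inl_left, mul_smul_comm]

lemma rid_inl_right (g : A →ₗ[ℂ] ℂ) (a : A) (t : A ⊗[ℂ] A) :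
    TensorProduct.rid ℂ A (LinearMap.lTensor A g ((inl a).right t)) =
      TensorProduct.rid ℂ A (LinearMap.lTensor A g t) * a := by
  induction t using TensorProduct.induction_on with
  | zero => simp
  | add w₁ w₂ h₁ h₂ => simp only [map_add, h₁, h₂, add_mul]
  | tmul y y' => simp [inl_right, smul_mul_assoc]

lemma inl_right_inr_right (a c : A) (w : A ⊗[ℂ] A) :
    (inl a).right ((inr c).right w) = w * (a ⊗ₜ[ℂ] c) := by
  induction w using TensorProduct.induction_on with
  | zero => simp
  | add w₁ w₂ h₁ h₂ => simp only [map_add, h₁, h₂, add_mul]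
  | tmul y y' => simp [inl_right, inr_right]

end MultiplierAlgebra

end Multipliers

/-! ## Non-degeneracy of tensor products -/

section Nondegenerate

variable {A : Type*} [NonUnitalRing A] [Module ℂ A] [IsScalarTower ℂ A A] [SMulCommClass ℂ A A]

/-- Slice maps on the second leg separate the elements of a tensor product. -/
lemma tensor_eq_zero_of_slices {V W : Type*} [AddCommGroup V] [Module ℂ V] [AddCommGroup W]
    [Module ℂ W] (t : V ⊗[ℂ] W)
    (h : ∀ g : W →ₗ[ℂ] ℂ, TensorProduct.rid ℂ V (LinearMap.lTensor V g t) = 0) : t = 0 := by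
  classical
  let b := Module.Basis.ofVectorSpace ℂ W
  apply (TensorProduct.equivFinsuppOfBasisRight (M := V) b).injective
  rw [map_zero]
  ext i
  rw [Finsupp.zero_apply, ← h (b.coord i)]
  clear h
  induction t using TensorProduct.induction_on with
  | zero => simp
  | add x y hx hy => simp_all
  | tmul x y => simp

lemma tensor_eq_zero_of_mul_left
    (hA : ∀ a : A, (∀ x, x * a = 0) → a = 0) (t : A ⊗[ℂ] A) (h : ∀ z, z * t = 0) : t = 0 := by
  have key : ∀ (f : A →ₗ[ℂ] ℂ) (a : A),
      TensorProduct.lid ℂ A (LinearMap.rTensor A (f ∘ₗ LinearMap.mulLeft ℂ a) t) = 0 := by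
    intro f a
    apply hA
    intro c
    have : ∀ s : A ⊗[ℂ] A,
        c * TensorProduct.lid ℂ A (LinearMap.rTensor A (f ∘ₗ LinearMap.mulLeft ℂ a) s)
          = TensorProduct.lid ℂ A (LinearMap.rTensor A f ((a ⊗ₜ[ℂ] c) * s)) := by
      intro s
      induction s using TensorProduct.induction_on with
      | zero => simp
      | add x y hx hy => simp_all [mul_add]
      | tmul x y => simp [mul_smul_comm]
    rw [this, h]
    simp
  apply tensor_eq_zero_of_slices
  intro g
  apply hA
  intro a
  refine (Module.forall_dual_apply_eq_zero_iff ℂ _).1 fun f => ?_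
  have : ∀ s : A ⊗[ℂ] A,
      f (a * TensorProduct.rid ℂ A (LinearMap.lTensor A g s))
        = g (TensorProduct.lid ℂ A (LinearMap.rTensor A (f ∘ₗ LinearMap.mulLeft ℂ a) s)) := by
    intro s
    induction s using TensorProduct.induction_on with
    | zero => simp
    | add x y hx hy => simp only [map_add, mul_add, hx, hy]
    | tmul x y => simp [mul_smul_comm, mul_comm]
  rw [this, key]
  simp

end Nondegenerate

/-! ## Multiplier Hopf `*`-algebras with positive integrals -/

/-- A multiplier Hopf `*`-algebra: a `*`-algebra `A` over `ℂ` with non-degenerate product and a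
comultiplication `Δ : A → M(A ⊗ A)` such that `a ⊗ a' ↦ Δ(a)(1 ⊗ a')` and
`a ⊗ a' ↦ (a ⊗ 1)Δ(a')` are bijections of `A ⊗ A` onto (the image in `M(A ⊗ A)` of) `A ⊗ A`.
As `A ⊗ A` embeds in `M(A ⊗ A)`, the maps `T₁` and `T₂` are determined by `Δ`. -/
structure MultiplierHopfStarAlgebra (A : Type*) [NonUnitalRing A] [Module ℂ A]
    [IsScalarTower ℂ A A] [SMulCommClass ℂ A A] [StarRing A] [StarModule ℂ A] where
  nondeg_left : ∀ a : A, (∀ x, x * a = 0) → a = 0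
  nondeg_right : ∀ a : A, (∀ x, a * x = 0) → a = 0
  /-- The comultiplication. -/
  Δ : A →⋆ₙₐ[ℂ] MultiplierAlgebra (A ⊗[ℂ] A)
  /-- `Δ(A)(A ⊗ A) = A ⊗ A`. -/
  Δ_nondeg : Submodule.span ℂ {t | ∃ (a : A) (z : A ⊗[ℂ] A), t = (Δ a).left z} = ⊤
  /-- The bijection `T₁(a ⊗ a') = Δ(a)(1 ⊗ a')`. -/
  T₁ : (A ⊗[ℂ] A) ≃ₗ[ℂ] (A ⊗[ℂ] A)
  T₁_spec : ∀ a a', MultiplierAlgebra.of (T₁ (a ⊗ₜ[ℂ] a')) = Δ a * MultiplierAlgebra.inr a'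
  /-- The bijection `T₂(a ⊗ a') = (a ⊗ 1)Δ(a')`. -/
  T₂ : (A ⊗[ℂ] A) ≃ₗ[ℂ] (A ⊗[ℂ] A)
  T₂_spec : ∀ a a', MultiplierAlgebra.of (T₂ (a ⊗ₜ[ℂ] a')) = MultiplierAlgebra.inl a * Δ a'
  /-- Coassociativity, in the covered form
  `(a ⊗ 1 ⊗ 1) (Δ ⊗ ι)(Δ(b)(1 ⊗ c)) = (ι ⊗ Δ)((a ⊗ 1)Δ(b)) (1 ⊗ 1 ⊗ c)`,
  that is, `(T₂ ⊗ ι)(ι ⊗ T₁) = (ι ⊗ T₁)(T₂ ⊗ ι)`. -/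
  coassoc : ∀ a b c : A,
    LinearMap.rTensor A T₂.toLinearMap
        ((TensorProduct.assoc ℂ A A A).symm (a ⊗ₜ[ℂ] T₁ (b ⊗ₜ[ℂ] c))) =
      (TensorProduct.assoc ℂ A A A).symm
        (LinearMap.lTensor A T₁.toLinearMap
          (TensorProduct.assoc ℂ A A A (T₂ (a ⊗ₜ[ℂ] b) ⊗ₜ[ℂ] c)))

/-- A multiplier Hopf `*`-algebra together with a positive left integral `φ`, i.e. a non-zero
positive linear functional with `(ι ⊗ φ)Δ(a) = φ(a)1`. -/
structure StarAlgebraicQuantumGroup (A : Type*) [NonUnitalRing A] [Module ℂ A]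
    [IsScalarTower ℂ A A] [SMulCommClass ℂ A A] [StarRing A] [StarModule ℂ A] extends
    MultiplierHopfStarAlgebra A where
  /-- The left integral. -/
  φ : A →ₗ[ℂ] ℂ
  φ_ne_zero : φ ≠ 0
  φ_pos : ∀ a : A, 0 ≤ (φ (star a * a)).re ∧ (φ (star a * a)).im = 0
  /-- `(ι ⊗ φ)((a' ⊗ 1)Δ(a)) = φ(a)a'`. -/
  φ_left_invariant : ∀ a' a : A,
    TensorProduct.rid ℂ A (LinearMap.lTensor A φ (T₂ (a' ⊗ₜ[ℂ] a))) = φ a • a'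

namespace MultiplierHopfStarAlgebra

variable {A : Type*} [NonUnitalRing A] [Module ℂ A] [IsScalarTower ℂ A A] [SMulCommClass ℂ A A]
  [StarRing A] [StarModule ℂ A] (H : MultiplierHopfStarAlgebra A)

/-- `ε` is the counit: `(ε ⊗ ι)(Δ(a)(1 ⊗ b)) = ab` and `(ι ⊗ ε)((a ⊗ 1)Δ(b)) = ab`. -/
def IsCounit (ε : A →ₗ[ℂ] ℂ) : Prop :=
  (∀ a b, TensorProduct.lid ℂ A (LinearMap.rTensor A ε (H.T₁ (a ⊗ₜ[ℂ] b))) = a * b) ∧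
  (∀ a b, TensorProduct.rid ℂ A (LinearMap.lTensor A ε (H.T₂ (a ⊗ₜ[ℂ] b))) = a * b)

/-- `S` is the (bijective) antipode: `m(S ⊗ ι)(Δ(a)(1 ⊗ b)) = ε(a)b` and
`m(ι ⊗ S)((a ⊗ 1)Δ(b)) = ε(b)a` where `ε` is the counit. -/
def IsAntipode (S : A ≃ₗ[ℂ] A) : Prop :=
  ∃ ε : A →ₗ[ℂ] ℂ, H.IsCounit ε ∧
    (∀ a b, LinearMap.mul' ℂ A (LinearMap.rTensor A S.toLinearMap (H.T₁ (a ⊗ₜ[ℂ] b))) = ε a • b) ∧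
    (∀ a b, LinearMap.mul' ℂ A (LinearMap.lTensor A S.toLinearMap (H.T₂ (a ⊗ₜ[ℂ] b))) = ε b • a)

/-- The map `V(x ⊗ x') = Δ(x')(x ⊗ 1)` as a bijection of `A ⊗ A`. By applying the involution it is
obtained from `T₂`; see `V_spec` for the defining formula. -/
noncomputable def V : (A ⊗[ℂ] A) ≃ₗ[ℂ] (A ⊗[ℂ] A) :=
  ((starLinearEquiv ℂ (A := A ⊗[ℂ] A)).trans H.T₂).trans (starLinearEquiv ℂ (A := A ⊗[ℂ] A))

lemma V_tmul (x x' : A) : H.V (x ⊗ₜ[ℂ] x') = star (H.T₂ (star x ⊗ₜ[ℂ] star x')) := rfl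

lemma T₁_mul (a b : A) (z : A ⊗[ℂ] A) :
    H.T₁ (a ⊗ₜ[ℂ] b) * z = (H.Δ a).left ((MultiplierAlgebra.inr b).left z) := by
  rw [← MultiplierAlgebra.of_left, T₁_spec, MultiplierAlgebra.left_prod]

lemma mul_T₁ (a b : A) (z : A ⊗[ℂ] A) :
    z * H.T₁ (a ⊗ₜ[ℂ] b) = (MultiplierAlgebra.inr b).right ((H.Δ a).right z) := by
  rw [← MultiplierAlgebra.of_right, T₁_spec, MultiplierAlgebra.right_prod]

lemma T₂_mul (a b : A) (z : A ⊗[ℂ] A) :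
    H.T₂ (a ⊗ₜ[ℂ] b) * z = (MultiplierAlgebra.inl a).left ((H.Δ b).left z) := by
  rw [← MultiplierAlgebra.of_left, T₂_spec, MultiplierAlgebra.left_prod]

lemma mul_T₂ (a b : A) (z : A ⊗[ℂ] A) :
    z * H.T₂ (a ⊗ₜ[ℂ] b) = (H.Δ b).right ((MultiplierAlgebra.inl a).right z) := by
  rw [← MultiplierAlgebra.of_right, T₂_spec, MultiplierAlgebra.right_prod]

lemma star_inl_right (x : A) (z : A ⊗[ℂ] A) :
    star ((MultiplierAlgebra.inl (star x)).right (star z)) = (MultiplierAlgebra.inl x).left z := by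
  induction z using TensorProduct.induction_on with
  | zero => simp
  | add z₁ z₂ h₁ h₂ => simp_all
  | tmul y y' =>
    simp [TensorProduct.star_tmul, MultiplierAlgebra.inl_left, MultiplierAlgebra.inl_right]

lemma star_inl_left (x : A) (z : A ⊗[ℂ] A) :
    star ((MultiplierAlgebra.inl (star x)).left (star z)) = (MultiplierAlgebra.inl x).right z := by
  induction z using TensorProduct.induction_on with
  | zero => simp
  | add z₁ z₂ h₁ h₂ => simp_all
  | tmul y y' =>
    simp [TensorProduct.star_tmul, MultiplierAlgebra.inl_left, MultiplierAlgebra.inl_right]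

lemma V_mul (x x' : A) (z : A ⊗[ℂ] A) :
    H.V (x ⊗ₜ[ℂ] x') * z = (H.Δ x').left ((MultiplierAlgebra.inl x).left z) := by
  apply star_injective
  rw [V_tmul, star_mul, star_star, mul_T₂, map_star H.Δ, MultiplierAlgebra.star_right,
    ← star_inl_right x z]

lemma mul_V (x x' : A) (z : A ⊗[ℂ] A) :
    z * H.V (x ⊗ₜ[ℂ] x') = (MultiplierAlgebra.inl x).right ((H.Δ x').right z) := by
  apply star_injective
  rw [V_tmul, star_mul, star_star, T₂_mul, map_star H.Δ, MultiplierAlgebra.star_left,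
    ← star_inl_left x, star_star, star_star]

/-- The defining formula of `V`. -/
lemma V_spec (x x' : A) :
    MultiplierAlgebra.of (H.V (x ⊗ₜ[ℂ] x')) = H.Δ x' * MultiplierAlgebra.inl x := by
  apply Subtype.ext
  apply Prod.ext
  · exact LinearMap.ext fun z => H.V_mul x x' z
  · apply MulOpposite.unop_injective
    exact LinearMap.ext fun z => H.mul_V x x' z

end MultiplierHopfStarAlgebra

/-! ## The dual -/

namespace StarAlgebraicQuantumGroup

variable {A : Type*} [NonUnitalRing A] [Module ℂ A] [IsScalarTower ℂ A A] [SMulCommClass ℂ A A]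
  [StarRing A] [StarModule ℂ A] (Q : StarAlgebraicQuantumGroup A)

/-- The map `a ↦ φ(· a)` from `A` to its linear dual. -/
def fourierFun : A →ₗ[ℂ] (A →ₗ[ℂ] ℂ) where
  toFun a := Q.φ ∘ₗ LinearMap.mulRight ℂ a
  map_add' a b := by ext x; simp [mul_add]
  map_smul' r a := by ext x; simp [mul_smul_comm]

lemma fourierFun_apply (a x : A) : Q.fourierFun a x = Q.φ (x * a) := rfl

/-- The underlying space of the dual `B`: all functionals `φ(· a)` with `a ∈ A`. -/
def Dual : Type _ := LinearMap.range Q.fourierFun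

instance : AddCommGroup Q.Dual := inferInstanceAs (AddCommGroup (LinearMap.range Q.fourierFun))

instance : Module ℂ Q.Dual := inferInstanceAs (Module ℂ (LinearMap.range Q.fourierFun))

/-- The elements of `B` as functionals on `A`: `Q.ev b a = ⟨a, b⟩`. -/
def ev : Q.Dual →ₗ[ℂ] (A →ₗ[ℂ] ℂ) := (LinearMap.range Q.fourierFun).subtype

lemma ev_injective : Function.Injective Q.ev := Subtype.val_injective

/-- The Fourier transform `F : A → B`, `F(a) = φ(· a)`. -/
def fourier : A →ₗ[ℂ] Q.Dual := Q.fourierFun.rangeRestrict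

lemma ev_fourier (a x : A) : Q.ev (Q.fourier a) x = Q.φ (x * a) := rfl

lemma fourier_surjective : Function.Surjective Q.fourier := LinearMap.surjective_rangeRestrict _

/-- Some `c` with `b = φ(· c)`. -/
noncomputable def density (b : Q.Dual) : A := (Q.fourier_surjective b).choose

lemma fourier_density (b : Q.Dual) : Q.fourier (Q.density b) = b :=
  (Q.fourier_surjective b).choose_spec

/-- The slice `(ι ⊗ b)Δ(x) = x₍₁₎⟨x₍₂₎, b⟩ ∈ A`. With `b = φ(· c)` it is
`(ι ⊗ φ)(Δ(x)(1 ⊗ c))`; see `mul_sliceR` for its defining property in `M(A)`. -/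
noncomputable def sliceR (b : Q.Dual) : A →ₗ[ℂ] A :=
  (TensorProduct.rid ℂ A).toLinearMap ∘ₗ LinearMap.lTensor A Q.φ ∘ₗ Q.T₁.toLinearMap ∘ₗ
    (TensorProduct.mk ℂ A A).flip (Q.density b)

/-- The slice `(b ⊗ ι)Δ(x) = ⟨x₍₁₎, b⟩x₍₂₎ ∈ A`. With `b = φ(· c)` it is
`(φ ⊗ ι)(Δ(x)(c ⊗ 1))`; see `sliceL_mul` for its defining property in `M(A)`. -/
noncomputable def sliceL (b : Q.Dual) : A →ₗ[ℂ] A :=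
  (TensorProduct.lid ℂ A).toLinearMap ∘ₗ LinearMap.rTensor A Q.φ ∘ₗ Q.V.toLinearMap ∘ₗ
    TensorProduct.mk ℂ A A (Q.density b)

lemma eq_of_forall_mul_tensor (Q : StarAlgebraicQuantumGroup A) {s t : A ⊗[ℂ] A} (h : ∀ z, z * s = z * t) : s = t :=
  sub_eq_zero.1 <| tensor_eq_zero_of_mul_left Q.nondeg_left _ fun z => by
    rw [mul_sub, h, sub_self]

lemma inl_T₁ (a x c : A) : (MultiplierAlgebra.inl a).left (Q.T₁ (x ⊗ₜ[ℂ] c)) =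
    (MultiplierAlgebra.inr c).right (Q.T₂ (a ⊗ₜ[ℂ] x)) := by
  apply Q.eq_of_forall_mul_tensor
  intro z
  rw [MultiplierAlgebra.mul_left, Q.mul_T₁, ← MultiplierAlgebra.right_mul, Q.mul_T₂]

lemma inl_V (a x c : A) : (MultiplierAlgebra.inl a).left (Q.V (c ⊗ₜ[ℂ] x)) =
    (MultiplierAlgebra.inl c).right (Q.T₂ (a ⊗ₜ[ℂ] x)) := by
  apply Q.eq_of_forall_mul_tensor
  intro z
  rw [MultiplierAlgebra.mul_left, Q.mul_V, ← MultiplierAlgebra.right_mul, Q.mul_T₂]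

lemma inr_V (a x c : A) : (MultiplierAlgebra.inr a).right (Q.V (c ⊗ₜ[ℂ] x)) =
    (MultiplierAlgebra.inl c).right (Q.T₁ (x ⊗ₜ[ℂ] a)) := by
  apply Q.eq_of_forall_mul_tensor
  intro z
  rw [← MultiplierAlgebra.right_mul, ← MultiplierAlgebra.right_mul, Q.mul_V, Q.mul_T₁]
  generalize (Q.Δ x).right z = w
  induction w using TensorProduct.induction_on with
  | zero => simp
  | add w₁ w₂ h₁ h₂ => simp only [map_add, h₁, h₂]
  | tmul y y' => simp only [MultiplierAlgebra.inl_right, MultiplierAlgebra.inr_right]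

/-- `a ((ι ⊗ b)Δ(x)) = (ι ⊗ b)((a ⊗ 1)Δ(x))`. -/
lemma mul_sliceR (b : Q.Dual) (a x : A) :
    a * Q.sliceR b x = TensorProduct.rid ℂ A (LinearMap.lTensor A (Q.ev b) (Q.T₂ (a ⊗ₜ[ℂ] x))) := by
  have h : a * Q.sliceR b x = TensorProduct.rid ℂ A (LinearMap.lTensor A Q.φ
      ((MultiplierAlgebra.inl a).left (Q.T₁ (x ⊗ₜ[ℂ] Q.density b)))) :=
    (MultiplierAlgebra.rid_inl Q.φ a _).symm
  rw [h, inl_T₁]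
  conv_rhs => rw [← Q.fourier_density b]
  generalize Q.T₂ (a ⊗ₜ[ℂ] x) = t
  induction t using TensorProduct.induction_on with
  | zero => simp
  | add w₁ w₂ h₁ h₂ => simp only [map_add, h₁, h₂]
  | tmul y y' => simp [MultiplierAlgebra.inr_right, ev_fourier]

/-- `((b ⊗ ι)Δ(x)) a = (b ⊗ ι)(Δ(x)(1 ⊗ a))`. -/
lemma sliceL_mul (b : Q.Dual) (a x : A) :
    Q.sliceL b x * a = TensorProduct.lid ℂ A (LinearMap.rTensor A (Q.ev b) (Q.T₁ (x ⊗ₜ[ℂ] a))) := by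
  have h : Q.sliceL b x * a = TensorProduct.lid ℂ A (LinearMap.rTensor A Q.φ
      ((MultiplierAlgebra.inr a).right (Q.V (Q.density b ⊗ₜ[ℂ] x)))) := by
    simp only [sliceL, LinearMap.comp_apply, LinearEquiv.coe_coe, TensorProduct.mk_apply]
    generalize Q.V (Q.density b ⊗ₜ[ℂ] x) = t
    induction t using TensorProduct.induction_on with
    | zero => simp
    | add w₁ w₂ h₁ h₂ => simp only [map_add, h₁, h₂, add_mul]
    | tmul y y' => simp [MultiplierAlgebra.inr_right, smul_mul_assoc]
  rw [h, inr_V]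
  conv_rhs => rw [← Q.fourier_density b]
  generalize Q.T₁ (x ⊗ₜ[ℂ] a) = t
  induction t using TensorProduct.induction_on with
  | zero => simp
  | add w₁ w₂ h₁ h₂ => simp only [map_add, h₁, h₂]
  | tmul y y' => simp [MultiplierAlgebra.inl_right, ev_fourier]

lemma eq_of_forall_mul (Q : StarAlgebraicQuantumGroup A) {s t : A} (h : ∀ z, z * s = z * t) : s = t :=
  sub_eq_zero.1 <| Q.nondeg_left _ fun z => by rw [mul_sub, h, sub_self]

lemma sliceR_add (b b' : Q.Dual) : Q.sliceR (b + b') = Q.sliceR b + Q.sliceR b' := by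
  ext x
  apply Q.eq_of_forall_mul
  intro a
  simp [mul_sliceR, mul_add, LinearMap.lTensor_add]

lemma sliceR_smul (r : ℂ) (b : Q.Dual) : Q.sliceR (r • b) = r • Q.sliceR b := by
  ext x
  apply Q.eq_of_forall_mul
  intro a
  simp [mul_sliceR, mul_smul_comm, LinearMap.lTensor_smul]

lemma left_invariant_V (q p : A) :
    TensorProduct.rid ℂ A (LinearMap.lTensor A Q.φ (Q.V (q ⊗ₜ[ℂ] p))) = Q.φ p • q := by
  apply Q.eq_of_forall_mul
  intro a
  rw [← MultiplierAlgebra.rid_inl, inl_V, MultiplierAlgebra.rid_inl_right, Q.φ_left_invariant,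
    smul_mul_assoc, mul_smul_comm]

lemma mul_mem_dual (b b' : Q.Dual) : Q.ev b ∘ₗ Q.sliceR b' ∈ LinearMap.range Q.fourierFun := by
  have h1 : ∀ t : A ⊗[ℂ] A, ∃ d : A, ∀ x : A, Q.φ (TensorProduct.rid ℂ A
      (LinearMap.lTensor A Q.φ ((Q.Δ x).left (Q.V t)))) = Q.φ (x * d) := by
    intro t
    induction t using TensorProduct.induction_on with
    | zero => exact ⟨0, fun x => by simp⟩
    | add t₁ t₂ h₁ h₂ =>
      obtain ⟨d₁, h₁⟩ := h₁
      obtain ⟨d₂, h₂⟩ := h₂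
      exact ⟨d₁ + d₂, fun x => by simp only [map_add, h₁, h₂, mul_add]⟩
    | tmul q p =>
      refine ⟨Q.φ q • p, fun x => ?_⟩
      have : (Q.Δ x).left (Q.V (q ⊗ₜ[ℂ] p)) = Q.V (q ⊗ₜ[ℂ] (x * p)) := by
        apply Q.eq_of_forall_mul_tensor
        intro z
        rw [MultiplierAlgebra.mul_left, Q.mul_V, Q.mul_V, map_mul, MultiplierAlgebra.right_prod]
      rw [this, left_invariant_V, mul_smul_comm, map_smul, map_smul, smul_eq_mul, smul_eq_mul,
        mul_comm]
  obtain ⟨d, hd⟩ := h1 (Q.V.symm (Q.density b ⊗ₜ[ℂ] Q.density b'))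
  refine ⟨d, ?_⟩
  ext x
  rw [fourierFun_apply, ← hd x, LinearEquiv.apply_symm_apply]
  have h2 : (Q.Δ x).left (Q.density b ⊗ₜ[ℂ] Q.density b') =
      (MultiplierAlgebra.inl (Q.density b)).right (Q.T₁ (x ⊗ₜ[ℂ] Q.density b')) := by
    apply Q.eq_of_forall_mul_tensor
    intro z
    rw [MultiplierAlgebra.mul_left, ← MultiplierAlgebra.right_mul, Q.mul_T₁,
      MultiplierAlgebra.inl_right_inr_right]
  rw [h2, MultiplierAlgebra.rid_inl_right]
  conv_rhs => rw [← Q.fourier_density b]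
  rfl

/-- The product of `B`, dual to the coproduct of `A`: `⟨x, bb'⟩ = ⟨x₍₁₎, b⟩⟨x₍₂₎, b'⟩`. -/
noncomputable instance : Mul Q.Dual where
  mul b b' := ⟨Q.ev b ∘ₗ Q.sliceR b', Q.mul_mem_dual b b'⟩

lemma ev_mul (b b' : Q.Dual) (x : A) : Q.ev (b * b') x = Q.ev b (Q.sliceR b' x) := rfl

lemma T₂_sliceR (b : Q.Dual) (a x : A) :
    Q.T₂ (a ⊗ₜ[ℂ] Q.sliceR b x) = LinearMap.lTensor A (Q.sliceR b) (Q.T₂ (a ⊗ₜ[ℂ] x)) := by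
  let slice : (A ⊗[ℂ] A) ⊗[ℂ] A →ₗ[ℂ] A ⊗[ℂ] A :=
    (TensorProduct.rid ℂ (A ⊗[ℂ] A)).toLinearMap ∘ₗ LinearMap.lTensor (A ⊗[ℂ] A) Q.φ
  have h1 : ∀ t : A ⊗[ℂ] A, slice (LinearMap.rTensor A Q.T₂.toLinearMap
      ((TensorProduct.assoc ℂ A A A).symm (a ⊗ₜ[ℂ] t))) =
      Q.T₂ (a ⊗ₜ[ℂ] TensorProduct.rid ℂ A (LinearMap.lTensor A Q.φ t)) := by
    intro t
    induction t using TensorProduct.induction_on with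
    | zero => simp
    | add w₁ w₂ h₁ h₂ => simp only [map_add, h₁, h₂, TensorProduct.tmul_add]
    | tmul y y' => simp [slice]
  have h2 : ∀ t s : A ⊗[ℂ] A, ∀ y : A, slice ((TensorProduct.assoc ℂ A A A).symm (y ⊗ₜ[ℂ] s)) =
      y ⊗ₜ[ℂ] TensorProduct.rid ℂ A (LinearMap.lTensor A Q.φ s) := by
    intro t s y
    induction s using TensorProduct.induction_on with
    | zero => simp
    | add w₁ w₂ h₁ h₂ => simp only [map_add, h₁, h₂, TensorProduct.tmul_add]
    | tmul y y' => simp [slice]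
  have h3 : ∀ t : A ⊗[ℂ] A, slice ((TensorProduct.assoc ℂ A A A).symm
        (LinearMap.lTensor A Q.T₁.toLinearMap
          (TensorProduct.assoc ℂ A A A (t ⊗ₜ[ℂ] Q.density b)))) =
      LinearMap.lTensor A (Q.sliceR b) t := by
    intro t
    induction t using TensorProduct.induction_on with
    | zero => simp
    | add w₁ w₂ h₁ h₂ => simp only [map_add, h₁, h₂, TensorProduct.add_tmul]
    | tmul y y' =>
      rw [TensorProduct.assoc_tmul, LinearMap.lTensor_tmul, h2 0, LinearMap.lTensor_tmul]
      rfl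
  rw [← h3, ← Q.coassoc, h1]
  rfl

lemma sliceR_mul (b b' : Q.Dual) (x : A) :
    Q.sliceR (b * b') x = Q.sliceR b (Q.sliceR b' x) := by
  apply Q.eq_of_forall_mul
  intro a
  rw [mul_sliceR, mul_sliceR, T₂_sliceR]
  generalize Q.T₂ (a ⊗ₜ[ℂ] x) = t
  induction t using TensorProduct.induction_on with
  | zero => simp
  | add w₁ w₂ h₁ h₂ => simp only [map_add, h₁, h₂]
  | tmul y y' => simp [ev_mul]

noncomputable instance : NonUnitalRing Q.Dual where
  left_distrib a b c := Q.ev_injective <| by ext x; simp [ev_mul, sliceR_add]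
  right_distrib a b c := Q.ev_injective <| by ext x; simp [ev_mul]
  zero_mul a := Q.ev_injective <| by ext x; simp [ev_mul]
  mul_zero a := Q.ev_injective <| by
    ext x
    have : Q.sliceR 0 = 0 := by simpa using Q.sliceR_smul 0 0
    simp [ev_mul, this]
  mul_assoc a b c := Q.ev_injective <| by ext x; simp [ev_mul, sliceR_mul]

instance : IsScalarTower ℂ Q.Dual Q.Dual :=
  ⟨fun r a b => Q.ev_injective <| by ext x; simp [ev_mul]⟩

instance : SMulCommClass ℂ Q.Dual Q.Dual :=
  ⟨fun r a b => Q.ev_injective <| by ext x; simp [ev_mul, sliceR_smul]⟩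

/-! ## The coproduct of the dual and the maps of the statement -/

/-- The pairing of `B ⊗ B` with `A ⊗ A`. -/
noncomputable def ev₂ : Q.Dual ⊗[ℂ] Q.Dual →ₗ[ℂ] (A ⊗[ℂ] A →ₗ[ℂ] ℂ) :=
  TensorProduct.dualDistrib ℂ A A ∘ₗ TensorProduct.map Q.ev Q.ev

/-- `D` is the coproduct of `B`: the *opposite* of the coproduct dual to the product of `A`, so
`⟨x ⊗ x', D(y)⟩ = ⟨x'x, y⟩`, where `A ⊗ A` is paired with `M(B ⊗ B)` by extending the pairing with
`B ⊗ B`. As the product of `B` is dual to the coproduct of `A`, this means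
`⟨x ⊗ x', D(y)(e ⊗ e')⟩ = ⟨x'₍₁₎x₍₁₎, y⟩⟨x₍₂₎, e⟩⟨x'₍₂₎, e'⟩` and
`⟨x ⊗ x', (e ⊗ e')D(y)⟩ = ⟨x₍₁₎, e⟩⟨x'₍₁₎, e'⟩⟨x'₍₂₎x₍₂₎, y⟩`. -/
def IsDualComul (D : Q.Dual →ₙₐ[ℂ] MultiplierAlgebra (Q.Dual ⊗[ℂ] Q.Dual)) : Prop :=
  ∀ (y e e' : Q.Dual) (x x' : A),
    Q.ev₂ ((D y).left (e ⊗ₜ[ℂ] e')) (x ⊗ₜ[ℂ] x') = Q.ev y (Q.sliceR e' x' * Q.sliceR e x) ∧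
    Q.ev₂ ((D y).right (e ⊗ₜ[ℂ] e')) (x ⊗ₜ[ℂ] x') = Q.ev y (Q.sliceL e' x' * Q.sliceL e x)

/-- The left regular representation `W = V⁻¹` on `A ⊗ A`, where `V(x ⊗ x') = Δ(x')(x ⊗ 1)`. -/
noncomputable def W : (A ⊗[ℂ] A) ≃ₗ[ℂ] (A ⊗[ℂ] A) := Q.V.symm

/-- For a linear map `θ : A → A`, the bilinear map
`(y ⊗ y', x ⊗ x') ↦ ⟨θ(x), y⟩ y' ⊗ x'`. -/
noncomputable def contract (θ : A →ₗ[ℂ] A) (s : Q.Dual ⊗[ℂ] Q.Dual) (t : A ⊗[ℂ] A) :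
    Q.Dual ⊗[ℂ] A :=
  TensorProduct.lid ℂ (Q.Dual ⊗[ℂ] A)
    (LinearMap.rTensor (Q.Dual ⊗[ℂ] A) (TensorProduct.lift (θ.lcomp ℂ ℂ ∘ₗ Q.ev))
      (TensorProduct.tensorTensorTensorComm ℂ Q.Dual Q.Dual A A (s ⊗ₜ[ℂ] t)))

lemma contract_tmul (θ : A →ₗ[ℂ] A) (y y' : Q.Dual) (x x' : A) :
    Q.contract θ (y ⊗ₜ[ℂ] y') (x ⊗ₜ[ℂ] x') = Q.ev y (θ x) • (y' ⊗ₜ[ℂ] x') := by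
  simp [contract]

/-- `U(y ⊗ x) = ⟨θ(x₍₁₎), y₍₁₎⟩ y₍₂₎ ⊗ x₍₂₎` on `B ⊗ A`, where `D` is the coproduct of `B`. The
Sweedler expression is covered by multiplying with `b ⊗ a` from the right:
`U(y ⊗ x)(b ⊗ a) = ⟨θ(x₍₁₎), y₍₁₎⟩ y₍₂₎b ⊗ x₍₂₎a`, where `y₍₁₎ ⊗ y₍₂₎b = D(y)(1 ⊗ b) ∈ B ⊗ B` and
`x₍₁₎ ⊗ x₍₂₎a = Δ(x)(1 ⊗ a) ∈ A ⊗ A`. -/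
def IsSweedlerMap (D : Q.Dual →ₙₐ[ℂ] MultiplierAlgebra (Q.Dual ⊗[ℂ] Q.Dual)) (θ : A →ₗ[ℂ] A)
    (U : Q.Dual ⊗[ℂ] A →ₗ[ℂ] Q.Dual ⊗[ℂ] A) : Prop :=
  ∀ (y b : Q.Dual) (x a : A), ∃ s : Q.Dual ⊗[ℂ] Q.Dual,
    MultiplierAlgebra.of s = D y * MultiplierAlgebra.inr b ∧
    U (y ⊗ₜ[ℂ] x) * (b ⊗ₜ[ℂ] a) = Q.contract θ s (Q.T₁ (x ⊗ₜ[ℂ] a))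

/-- `L b` is the operator `λ(b)x = ⟨S⁻¹(x₍₁₎), b⟩x₍₂₎` on `A`; covered by multiplying with `a` from
the right, this reads `(λ(b)x)a = ⟨S⁻¹(x₍₁₎), b⟩x₍₂₎a` with `x₍₁₎ ⊗ x₍₂₎a = Δ(x)(1 ⊗ a)`. -/
def IsConvolutionAction (S : A ≃ₗ[ℂ] A) (L : Q.Dual →ₗ[ℂ] Module.End ℂ A) : Prop :=
  ∀ (b : Q.Dual) (x a : A), L b x * a = TensorProduct.lid ℂ A
    (LinearMap.rTensor A (Q.ev b ∘ₗ S.symm.toLinearMap) (Q.T₁ (x ⊗ₜ[ℂ] a)))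

/-- `b ⊗ a ↦ L(b)π(a)` with `π(a)x = ax` the multiplication operators on `A`. -/
noncomputable def convMul (L : Q.Dual →ₗ[ℂ] Module.End ℂ A) :
    Q.Dual ⊗[ℂ] A →ₗ[ℂ] Module.End ℂ A :=
  TensorProduct.lift ((LinearMap.mul ℂ (Module.End ℂ A)).compl₁₂ L (LinearMap.mul ℂ A))

/-- `b ⊗ a ↦ π(a)L(b)` with `π(a)x = ax` the multiplication operators on `A`. -/
noncomputable def mulConv (L : Q.Dual →ₗ[ℂ] Module.End ℂ A) :
    Q.Dual ⊗[ℂ] A →ₗ[ℂ] Module.End ℂ A :=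
  TensorProduct.lift ((LinearMap.mul ℂ (Module.End ℂ A)).flip.compl₁₂ L (LinearMap.mul ℂ A))

lemma convMul_tmul (L : Q.Dual →ₗ[ℂ] Module.End ℂ A) (b : Q.Dual) (a x : A) :
    Q.convMul L (b ⊗ₜ[ℂ] a) x = L b (a * x) := rfl

lemma mulConv_tmul (L : Q.Dual →ₗ[ℂ] Module.End ℂ A) (b : Q.Dual) (a x : A) :
    Q.mulConv L (b ⊗ₜ[ℂ] a) x = a * L b x := rfl

end StarAlgebraicQuantumGroup

/-! All maps are carried from A ⊗ A to B ⊗ A by F ⊗ ι. On A ⊗ A one has V(p ⊗ x) = x₍₁₎p ⊗ x₍₂₎,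
with inverse W(p ⊗ x) = S⁻¹(x₍₁₎)p ⊗ x₍₂₎ (`lTensor_mulRight_W`). For any linear θ, φ(zθ(x₍₁₎)p) =
⟨zθ(x₍₁₎), F(p)⟩ = ⟨θ(x₍₁₎) ⊗ z, Δ_B(F(p))⟩. So F turns left multiplication of p by θ(x₍₁₎) into
contraction of the first leg of Δ_B, the first because Δ_B is the opposite coproduct
(`isSweedlerMap_of_rTensor`). Taking θ = S⁻¹ gives U and θ = ι gives U⁻¹.

For the commutation relations, λ(F(p))x = (φ ⊗ ι)W(p ⊗ x). Multiplicativity of Δ reads Δ(a)V = V(1 ⊗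
a), that is (1 ⊗ a)W = WΔ(a); evaluating at p ⊗ x and slicing with φ gives the first relation
(`mulConv_rTensor`). The second is the first applied to U(b ⊗ a).

The rest constructs the objects. Counit and antipode come from T₁⁻¹, T₂⁻¹ and coassociativity; the
integral shows that S takes values in A and not only in M(A). Faithfulness of φ makes F injective.
The functional ψ = φ ∘ S is right invariant, and comparison of φ with ψ shows that B consists
equally of the functionals ψ(· c) and of the φ(a ·). The first description puts tΔ_B(y) in B ⊗ B,
the second Δ_B(y)(1 ⊗ b). -/

section Slices

/-! ### Slices of tensors by functionals, and separation by slices. -/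

variable {V W X : Type*} [AddCommGroup V] [Module ℂ V] [AddCommGroup W] [Module ℂ W]
  [AddCommGroup X] [Module ℂ X]

/-- The slice `f ⊗ ι` of a tensor product by a functional on the first leg. -/
noncomputable def sliceFst (f : V →ₗ[ℂ] ℂ) : V ⊗[ℂ] W →ₗ[ℂ] W :=
  (TensorProduct.lid ℂ W).toLinearMap ∘ₗ LinearMap.rTensor W f

/-- The slice `ι ⊗ g` of a tensor product by a functional on the second leg. -/
noncomputable def sliceSnd (g : W →ₗ[ℂ] ℂ) : V ⊗[ℂ] W →ₗ[ℂ] V :=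
  (TensorProduct.rid ℂ V).toLinearMap ∘ₗ LinearMap.lTensor V g

lemma sliceFst_apply (f : V →ₗ[ℂ] ℂ) (t : V ⊗[ℂ] W) :
    sliceFst f t = TensorProduct.lid ℂ W (LinearMap.rTensor W f t) := rfl

lemma sliceSnd_apply (g : W →ₗ[ℂ] ℂ) (t : V ⊗[ℂ] W) :
    sliceSnd g t = TensorProduct.rid ℂ V (LinearMap.lTensor V g t) := rfl

@[simp]
lemma sliceFst_tmul (f : V →ₗ[ℂ] ℂ) (v : V) (w : W) : sliceFst f (v ⊗ₜ[ℂ] w) = f v • w := by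
  simp [sliceFst]

@[simp]
lemma sliceSnd_tmul (g : W →ₗ[ℂ] ℂ) (v : V) (w : W) : sliceSnd g (v ⊗ₜ[ℂ] w) = g w • v := by
  simp [sliceSnd]

lemma sliceFst_lTensor (f : V →ₗ[ℂ] ℂ) (h : W →ₗ[ℂ] X) (t : V ⊗[ℂ] W) :
    sliceFst f (LinearMap.lTensor V h t) = h (sliceFst f t) := by
  induction t using TensorProduct.induction_on with
  | zero => simp
  | add s t hs ht => simp only [map_add, hs, ht]
  | tmul v w => simp

lemma sliceFst_rTensor (f : X →ₗ[ℂ] ℂ) (h : V →ₗ[ℂ] X) (t : V ⊗[ℂ] W) :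
    sliceFst f (LinearMap.rTensor W h t) = sliceFst (f ∘ₗ h) t := by
  induction t using TensorProduct.induction_on with
  | zero => simp
  | add s t hs ht => simp only [map_add, hs, ht]
  | tmul v w => simp

lemma sliceSnd_rTensor (g : W →ₗ[ℂ] ℂ) (h : V →ₗ[ℂ] X) (t : V ⊗[ℂ] W) :
    sliceSnd g (LinearMap.rTensor W h t) = h (sliceSnd g t) := by
  induction t using TensorProduct.induction_on with
  | zero => simp
  | add s t hs ht => simp only [map_add, hs, ht]
  | tmul v w => simp

lemma sliceSnd_lTensor (g : X →ₗ[ℂ] ℂ) (h : W →ₗ[ℂ] X) (t : V ⊗[ℂ] W) :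
    sliceSnd g (LinearMap.lTensor V h t) = sliceSnd (g ∘ₗ h) t := by
  induction t using TensorProduct.induction_on with
  | zero => simp
  | add s t hs ht => simp only [map_add, hs, ht]
  | tmul v w => simp

lemma sliceFst_sliceSnd (f : V →ₗ[ℂ] ℂ) (g : W →ₗ[ℂ] ℂ) (t : V ⊗[ℂ] W) :
    f (sliceSnd g t) = g (sliceFst f t) := by
  induction t using TensorProduct.induction_on with
  | zero => simp
  | add s t hs ht => simp only [map_add, hs, ht]
  | tmul v w => simp [mul_comm]

lemma tensor_eq_zero_of_sliceSnd (t : V ⊗[ℂ] W) (h : ∀ g : W →ₗ[ℂ] ℂ, sliceSnd g t = 0) : t = 0 :=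
  tensor_eq_zero_of_slices t h

lemma tensor_eq_zero_of_sliceFst (t : V ⊗[ℂ] W) (h : ∀ f : V →ₗ[ℂ] ℂ, sliceFst f t = 0) :
    t = 0 := by
  apply tensor_eq_zero_of_sliceSnd
  intro g
  refine (Module.forall_dual_apply_eq_zero_iff ℂ _).1 fun f => ?_
  rw [sliceFst_sliceSnd, h, map_zero]

/-- A family of maps on the second leg separates the tensors if it separates the second leg. -/
lemma tensor_eq_zero_of_lTensor {ι : Type*} {X : ι → Type*} [∀ i, AddCommGroup (X i)]
    [∀ i, Module ℂ (X i)] (h : ∀ i, W →ₗ[ℂ] X i) (hW : ∀ w, (∀ i, h i w = 0) → w = 0)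
    (t : V ⊗[ℂ] W) (ht : ∀ i, LinearMap.lTensor V (h i) t = 0) : t = 0 := by
  apply tensor_eq_zero_of_sliceFst
  intro f
  apply hW
  intro i
  rw [← sliceFst_lTensor, ht, map_zero]

lemma tensor_eq_zero_of_rTensor {ι : Type*} {X : ι → Type*} [∀ i, AddCommGroup (X i)]
    [∀ i, Module ℂ (X i)] (h : ∀ i, V →ₗ[ℂ] X i) (hV : ∀ v, (∀ i, h i v = 0) → v = 0)
    (t : V ⊗[ℂ] W) (ht : ∀ i, LinearMap.rTensor W (h i) t = 0) : t = 0 := by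
  apply tensor_eq_zero_of_sliceSnd
  intro g
  apply hV
  intro i
  rw [← sliceSnd_rTensor, ht, map_zero]

lemma lTensor_sliceFst_assoc (f : W →ₗ[ℂ] ℂ)
    (s : V ⊗[ℂ] W) (c : X) :
    LinearMap.lTensor V (sliceFst f) (TensorProduct.assoc ℂ V W X (s ⊗ₜ[ℂ] c)) = sliceSnd f s ⊗ₜ[ℂ] c := by
  induction s using TensorProduct.induction_on with
  | zero => simp
  | add s t hs ht => simp only [map_add, TensorProduct.add_tmul, hs, ht]
  | tmul a b => simp [TensorProduct.tmul_smul, TensorProduct.smul_tmul']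

end Slices

namespace StarAlgebraicQuantumGroup

open LinearMap (lTensor rTensor mulLeft mulRight)

/-! ### Multiplication on one leg of A ⊗ A. -/

section Legs

variable {A : Type*} [NonUnitalRing A] [Module ℂ A] [IsScalarTower ℂ A A] [SMulCommClass ℂ A A]

lemma inl_right_eq (a : A) (t : A ⊗[ℂ] A) :
    (MultiplierAlgebra.inl a).right t = rTensor A (mulRight ℂ a) t := rfl

lemma inr_left_eq (a : A) (t : A ⊗[ℂ] A) :
    (MultiplierAlgebra.inr a).left t = lTensor A (mulLeft ℂ a) t := rfl

lemma inr_right_eq (a : A) (t : A ⊗[ℂ] A) :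
    (MultiplierAlgebra.inr a).right t = lTensor A (mulRight ℂ a) t := rfl

lemma mul_lTensor_mulLeft (b : A) (z t : A ⊗[ℂ] A) :
    z * lTensor A (mulLeft ℂ b) t = lTensor A (mulRight ℂ b) z * t :=
  MultiplierAlgebra.mul_left (MultiplierAlgebra.inr b) z t

lemma mul_rTensor_mulLeft (b : A) (z t : A ⊗[ℂ] A) :
    z * rTensor A (mulLeft ℂ b) t = rTensor A (mulRight ℂ b) z * t :=
  MultiplierAlgebra.mul_left (MultiplierAlgebra.inl b) z t

lemma mul_lTensor_mulRight (b : A) (z t : A ⊗[ℂ] A) :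
    z * lTensor A (mulRight ℂ b) t = lTensor A (mulRight ℂ b) (z * t) :=
  ((MultiplierAlgebra.inr b).right_mul z t).symm

lemma mul_rTensor_mulRight (b : A) (z t : A ⊗[ℂ] A) :
    z * rTensor A (mulRight ℂ b) t = rTensor A (mulRight ℂ b) (z * t) :=
  ((MultiplierAlgebra.inl b).right_mul z t).symm

lemma lTensor_mul'_assoc (s : A ⊗[ℂ] A) (c : A) :
    lTensor A (LinearMap.mul' ℂ A) (TensorProduct.assoc ℂ A A A (s ⊗ₜ[ℂ] c)) =
      lTensor A (mulRight ℂ c) s := by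
  induction s using TensorProduct.induction_on with
  | zero => simp
  | add s t hs ht => simp only [map_add, TensorProduct.add_tmul, hs, ht]
  | tmul a b => simp

/-- The opposite multiplication `x ⊗ x' ↦ x'x`. -/
noncomputable def mulOp : A ⊗[ℂ] A →ₗ[ℂ] A :=
  LinearMap.mul' ℂ A ∘ₗ (TensorProduct.comm ℂ A A).toLinearMap

@[simp]
lemma mulOp_tmul (x x' : A) : mulOp (x ⊗ₜ[ℂ] x') = x' * x := by simp [mulOp]

end Legs

lemma comm_star {A : Type*} [NonUnitalRing A] [Module ℂ A] [StarRing A] [StarModule ℂ A]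
    (t : A ⊗[ℂ] A) :
    TensorProduct.comm ℂ A A (star t) = star (TensorProduct.comm ℂ A A t) := by
  induction t using TensorProduct.induction_on with
  | zero => simp
  | add s t hs ht => simp only [map_add, star_add, hs, ht]
  | tmul x y => simp [TensorProduct.star_tmul]

variable {A : Type*} [NonUnitalRing A] [Module ℂ A] [IsScalarTower ℂ A A] [SMulCommClass ℂ A A]
  [StarRing A] [StarModule ℂ A] (Q : StarAlgebraicQuantumGroup A)

lemma eq_of_forall_mul_right (Q : StarAlgebraicQuantumGroup A) {s t : A} (h : ∀ z, s * z = t * z) : s = t :=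
  sub_eq_zero.1 <| Q.nondeg_right _ fun z => by rw [sub_mul, h, sub_self]

section
variable {X : Type*} [AddCommGroup X] [Module ℂ X]

/-- Sweedler expressions are only given covered by a multiplication on some leg; non-degeneracy of
the product removes the cover. -/
lemma eq_of_lTensor_mulRight (Q : StarAlgebraicQuantumGroup A) {s t : X ⊗[ℂ] A}
    (h : ∀ a, lTensor X (mulRight ℂ a) s = lTensor X (mulRight ℂ a) t) : s = t :=
  sub_eq_zero.1 <| tensor_eq_zero_of_lTensor (fun a : A => mulRight ℂ a)
    (fun w hw => Q.nondeg_right w hw) _ fun a => by rw [map_sub, h, sub_self]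

lemma eq_of_rTensor_mulLeft (Q : StarAlgebraicQuantumGroup A) {s t : A ⊗[ℂ] X}
    (h : ∀ a, rTensor X (mulLeft ℂ a) s = rTensor X (mulLeft ℂ a) t) : s = t :=
  sub_eq_zero.1 <| tensor_eq_zero_of_rTensor (fun a : A => mulLeft ℂ a)
    (fun w hw => Q.nondeg_left w hw) _ fun a => by rw [map_sub, h, sub_self]

end

/-! ### The four covered forms of the coproduct and their exchange. -/

/-- The bijection `T₄(x ⊗ b) = (1 ⊗ b)Δ(x)`. -/
noncomputable def T₄ : (A ⊗[ℂ] A) ≃ₗ[ℂ] (A ⊗[ℂ] A) :=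
  ((starLinearEquiv ℂ (A := A ⊗[ℂ] A)).trans Q.T₁).trans (starLinearEquiv ℂ (A := A ⊗[ℂ] A))

lemma T₄_apply (t : A ⊗[ℂ] A) : Q.T₄ t = star (Q.T₁ (star t)) := rfl

lemma star_lTensor_mulRight (a : A) (t : A ⊗[ℂ] A) :
    star (lTensor A (mulRight ℂ a) t) = lTensor A (mulLeft ℂ (star a)) (star t) := by
  induction t using TensorProduct.induction_on with
  | zero => simp
  | add s t hs ht => simp only [map_add, star_add, hs, ht]
  | tmul v w => simp [TensorProduct.star_tmul]

lemma mul_T₄ (x b : A) (z : A ⊗[ℂ] A) :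
    z * Q.T₄ (x ⊗ₜ[ℂ] b) = (Q.Δ x).right (lTensor A (mulRight ℂ b) z) := by
  apply star_injective
  rw [T₄_apply, star_mul, star_star, TensorProduct.star_tmul, Q.T₁_mul, map_star Q.Δ,
    MultiplierAlgebra.star_left, inr_left_eq, ← star_lTensor_mulRight, star_star]

/-- Both sides are (1 ⊗ b)Δ(x)(1 ⊗ c), bracketed differently. This lemma and its variants below
exchange one cover of Δ(x) for another. -/
lemma T₁_T₄ (x b c : A) : lTensor A (mulLeft ℂ b) (Q.T₁ (x ⊗ₜ[ℂ] c)) =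
    lTensor A (mulRight ℂ c) (Q.T₄ (x ⊗ₜ[ℂ] b)) := by
  apply Q.eq_of_forall_mul_tensor
  intro z
  rw [mul_lTensor_mulLeft, Q.mul_T₁, mul_lTensor_mulRight, mul_T₄]
  rfl

lemma T₁_T₂ (a x c : A) : rTensor A (mulLeft ℂ a) (Q.T₁ (x ⊗ₜ[ℂ] c)) =
    lTensor A (mulRight ℂ c) (Q.T₂ (a ⊗ₜ[ℂ] x)) := Q.inl_T₁ a x c

lemma V_T₂ (a x c : A) : rTensor A (mulLeft ℂ a) (Q.V (c ⊗ₜ[ℂ] x)) =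
    rTensor A (mulRight ℂ c) (Q.T₂ (a ⊗ₜ[ℂ] x)) := Q.inl_V a x c

lemma V_T₁ (a x c : A) : lTensor A (mulRight ℂ a) (Q.V (c ⊗ₜ[ℂ] x)) =
    rTensor A (mulRight ℂ c) (Q.T₁ (x ⊗ₜ[ℂ] a)) := Q.inr_V a x c

lemma T₂_T₄ (a x b : A) : lTensor A (mulLeft ℂ b) (Q.T₂ (a ⊗ₜ[ℂ] x)) =
    rTensor A (mulLeft ℂ a) (Q.T₄ (x ⊗ₜ[ℂ] b)) := by
  apply Q.eq_of_forall_mul_tensor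
  intro z
  rw [mul_lTensor_mulLeft, mul_rTensor_mulLeft, Q.mul_T₂, mul_T₄, inl_right_eq]
  congr 1
  rw [← LinearMap.comp_apply, ← LinearMap.comp_apply, LinearMap.rTensor_comp_lTensor,
    LinearMap.lTensor_comp_rTensor]

lemma T₁_mul_left (a b c : A) :
    Q.T₁ ((a * b) ⊗ₜ[ℂ] c) = (Q.Δ a).left (Q.T₁ (b ⊗ₜ[ℂ] c)) := by
  apply Q.eq_of_forall_mul_tensor
  intro z
  rw [MultiplierAlgebra.mul_left, Q.mul_T₁, Q.mul_T₁, map_mul, MultiplierAlgebra.right_prod]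

lemma V_mul_right (a b c : A) :
    Q.V (a ⊗ₜ[ℂ] (b * c)) = (Q.Δ b).left (Q.V (a ⊗ₜ[ℂ] c)) := by
  apply Q.eq_of_forall_mul_tensor
  intro z
  rw [MultiplierAlgebra.mul_left, Q.mul_V, Q.mul_V, map_mul, MultiplierAlgebra.right_prod]

lemma T₂_mul_right (a b c : A) :
    Q.T₂ (a ⊗ₜ[ℂ] (b * c)) = (Q.Δ c).right (Q.T₂ (a ⊗ₜ[ℂ] b)) := by
  apply Q.eq_of_forall_mul_tensor
  intro z
  rw [← MultiplierAlgebra.right_mul, Q.mul_T₂, Q.mul_T₂, map_mul, MultiplierAlgebra.right_prod]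

lemma Δ_left_tmul (a b c : A) :
    (Q.Δ a).left (b ⊗ₜ[ℂ] c) = rTensor A (mulRight ℂ b) (Q.T₁ (a ⊗ₜ[ℂ] c)) := by
  apply Q.eq_of_forall_mul_tensor
  intro z
  rw [MultiplierAlgebra.mul_left, mul_rTensor_mulRight, Q.mul_T₁, ← inl_right_eq,
    MultiplierAlgebra.inl_right_inr_right]

lemma Δ_left_tmul' (a b c : A) :
    (Q.Δ a).left (b ⊗ₜ[ℂ] c) = lTensor A (mulRight ℂ c) (Q.V (b ⊗ₜ[ℂ] a)) := by
  rw [Δ_left_tmul, V_T₁]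

lemma Δ_right_tmul (a b c : A) :
    (Q.Δ a).right (b ⊗ₜ[ℂ] c) = lTensor A (mulLeft ℂ c) (Q.T₂ (b ⊗ₜ[ℂ] a)) := by
  apply Q.eq_of_forall_mul_tensor
  intro z
  rw [← MultiplierAlgebra.right_mul, mul_lTensor_mulLeft, Q.mul_T₂, ← inr_right_eq,
    MultiplierAlgebra.inl_right_inr_right]

/-! ### Coassociativity -/

/-- `T₂` acting on the first two legs. -/
noncomputable def T₂leg : (A ⊗[ℂ] (A ⊗[ℂ] A)) ≃ₗ[ℂ] (A ⊗[ℂ] (A ⊗[ℂ] A)) :=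
  ((TensorProduct.assoc ℂ A A A).symm.trans
    (TensorProduct.congr Q.T₂ (LinearEquiv.refl ℂ A))).trans (TensorProduct.assoc ℂ A A A)

/-- `T₁` acting on the last two legs. -/
noncomputable def T₁leg : (A ⊗[ℂ] (A ⊗[ℂ] A)) ≃ₗ[ℂ] (A ⊗[ℂ] (A ⊗[ℂ] A)) :=
  TensorProduct.congr (LinearEquiv.refl ℂ A) Q.T₁

lemma T₁leg_tmul (a : A) (t : A ⊗[ℂ] A) : Q.T₁leg (a ⊗ₜ[ℂ] t) = a ⊗ₜ[ℂ] Q.T₁ t := rfl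

lemma T₁leg_symm_tmul (a : A) (t : A ⊗[ℂ] A) :
    Q.T₁leg.symm (a ⊗ₜ[ℂ] t) = a ⊗ₜ[ℂ] Q.T₁.symm t := rfl

lemma T₂leg_assoc (s : A ⊗[ℂ] A) (c : A) :
    Q.T₂leg (TensorProduct.assoc ℂ A A A (s ⊗ₜ[ℂ] c)) =
      TensorProduct.assoc ℂ A A A (Q.T₂ s ⊗ₜ[ℂ] c) := by
  simp [T₂leg]

lemma T₂leg_tmul (a b c : A) :
    Q.T₂leg (a ⊗ₜ[ℂ] (b ⊗ₜ[ℂ] c)) = TensorProduct.assoc ℂ A A A (Q.T₂ (a ⊗ₜ[ℂ] b) ⊗ₜ[ℂ] c) :=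
  Q.T₂leg_assoc (a ⊗ₜ[ℂ] b) c

lemma T₂leg_symm_assoc (s : A ⊗[ℂ] A) (c : A) :
    Q.T₂leg.symm (TensorProduct.assoc ℂ A A A (s ⊗ₜ[ℂ] c)) =
      TensorProduct.assoc ℂ A A A (Q.T₂.symm s ⊗ₜ[ℂ] c) := by
  rw [LinearEquiv.symm_apply_eq, T₂leg_assoc, LinearEquiv.apply_symm_apply]

/-- `coassoc` on right-bracketed triple tensors, where both factors are equivalences and the
relation can be inverted. -/
lemma T₂leg_T₁leg (t : A ⊗[ℂ] (A ⊗[ℂ] A)) : Q.T₂leg (Q.T₁leg t) = Q.T₁leg (Q.T₂leg t) := by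
  induction t using TensorProduct.induction_on with
  | zero => simp
  | add s t hs ht => simp only [map_add, hs, ht]
  | tmul a w =>
    induction w using TensorProduct.induction_on with
    | zero => simp
    | add s t hs ht => simp only [map_add, TensorProduct.tmul_add, hs, ht]
    | tmul b c =>
      rw [T₁leg_tmul, T₂leg_tmul]
      exact (TensorProduct.assoc ℂ A A A).symm.injective <| by
        simpa [T₂leg, T₁leg, TensorProduct.congr, LinearMap.rTensor, LinearMap.lTensor]
          using Q.coassoc a b c

lemma T₁leg_symm_T₂leg (t : A ⊗[ℂ] (A ⊗[ℂ] A)) :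
    Q.T₁leg.symm (Q.T₂leg t) = Q.T₂leg (Q.T₁leg.symm t) := by
  rw [LinearEquiv.symm_apply_eq, ← T₂leg_T₁leg, LinearEquiv.apply_symm_apply]

lemma T₂leg_symm_T₁leg (t : A ⊗[ℂ] (A ⊗[ℂ] A)) :
    Q.T₂leg.symm (Q.T₁leg t) = Q.T₁leg (Q.T₂leg.symm t) := by
  rw [LinearEquiv.symm_apply_eq, T₂leg_T₁leg, LinearEquiv.apply_symm_apply]

/-! ### The counit -/

lemma exists_φ_eq_one : ∃ a, Q.φ a = 1 := by
  obtain ⟨a, ha⟩ := DFunLike.ne_iff.1 Q.φ_ne_zero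
  exact ⟨(Q.φ a)⁻¹ • a, by simpa using inv_mul_cancel₀ ha⟩

/-- By coassociativity T₁⁻¹ on the last legs passes through T₂ on the first ones. Multiplying the
last two legs then turns T₂ into (a ⊗ 1)T₁(·), and T₁ cancels T₁⁻¹. -/
lemma tmul_mul'_T₁_symm (u : A ⊗[ℂ] A) (c : A) :
    lTensor A (LinearMap.mul' ℂ A ∘ₗ Q.T₁.symm.toLinearMap)
      (TensorProduct.assoc ℂ A A A (Q.T₂ u ⊗ₜ[ℂ] c)) = LinearMap.mul' ℂ A u ⊗ₜ[ℂ] c := by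
  have h1 : ∀ t, lTensor A (LinearMap.mul' ℂ A ∘ₗ Q.T₁.symm.toLinearMap) t =
      lTensor A (LinearMap.mul' ℂ A) (Q.T₁leg.symm t) := by
    intro t
    induction t using TensorProduct.induction_on with
    | zero => simp
    | add s t hs ht => simp only [map_add, hs, ht]
    | tmul a w => simp [T₁leg_symm_tmul]
  have h2 : ∀ (a : A) (w : A ⊗[ℂ] A), lTensor A (LinearMap.mul' ℂ A) (Q.T₂leg (a ⊗ₜ[ℂ] w)) =
      rTensor A (mulLeft ℂ a) (Q.T₁ w) := by
    intro a w
    induction w using TensorProduct.induction_on with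
    | zero => simp
    | add s t hs ht => simp only [map_add, TensorProduct.tmul_add, hs, ht]
    | tmul b c =>
      rw [T₁_T₂, T₂leg_tmul]
      generalize Q.T₂ (a ⊗ₜ[ℂ] b) = t
      induction t using TensorProduct.induction_on with
      | zero => simp
      | add s t hs ht => simp only [map_add, TensorProduct.add_tmul, hs, ht]
      | tmul b c => simp
  rw [h1]
  induction u using TensorProduct.induction_on with
  | zero => simp
  | add s t hs ht => simp only [map_add, TensorProduct.add_tmul, hs, ht]
  | tmul a b =>
    rw [← T₂leg_tmul, T₁leg_symm_T₂leg, T₁leg_symm_tmul, h2, LinearEquiv.apply_symm_apply]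
    simp

/-- One side has first leg a, the other second leg c. Hence m(T₁⁻¹(b ⊗ c)) is a multiple of c whose
factor depends on b alone, and this factor is ε(b). -/
lemma tmul_mul'_T₁_symm_tmul (a b c : A) :
    a ⊗ₜ[ℂ] LinearMap.mul' ℂ A (Q.T₁.symm (b ⊗ₜ[ℂ] c)) =
      LinearMap.mul' ℂ A (Q.T₂.symm (a ⊗ₜ[ℂ] b)) ⊗ₜ[ℂ] c := by
  rw [← tmul_mul'_T₁_symm, LinearEquiv.apply_symm_apply]
  simp

lemma exists_counit : ∃ ε : A →ₗ[ℂ] ℂ,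
    (∀ t, LinearMap.mul' ℂ A (Q.T₁.symm t) = sliceFst ε t) ∧
    (∀ t, LinearMap.mul' ℂ A (Q.T₂.symm t) = sliceSnd ε t) := by
  obtain ⟨a₀, ha₀⟩ := Q.exists_φ_eq_one
  -- Here φ serves only as a functional with φ(a₀) = 1, to read off the scalar.
  let ε : A →ₗ[ℂ] ℂ := Q.φ ∘ₗ LinearMap.mul' ℂ A ∘ₗ Q.T₂.symm.toLinearMap ∘ₗ
    TensorProduct.mk ℂ A A a₀
  have h1 : ∀ b c, LinearMap.mul' ℂ A (Q.T₁.symm (b ⊗ₜ[ℂ] c)) = ε b • c := by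
    intro b c
    have := congrArg (sliceFst Q.φ) (Q.tmul_mul'_T₁_symm_tmul a₀ b c)
    simp only [sliceFst_tmul, ha₀, one_smul] at this
    exact this
  have h2 : ∀ a b, LinearMap.mul' ℂ A (Q.T₂.symm (a ⊗ₜ[ℂ] b)) = ε b • a := by
    intro a b
    have := congrArg (sliceSnd Q.φ) (Q.tmul_mul'_T₁_symm_tmul a b a₀)
    rw [h1] at this
    simp only [sliceSnd_tmul, map_smul, smul_eq_mul, ha₀, one_smul, mul_one] at this
    exact this.symm
  refine ⟨ε, fun t => ?_, fun t => ?_⟩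
  · induction t using TensorProduct.induction_on with
    | zero => simp
    | add s t hs ht => simp only [map_add, hs, ht]
    | tmul b c => rw [h1, sliceFst_tmul]
  · induction t using TensorProduct.induction_on with
    | zero => simp
    | add s t hs ht => simp only [map_add, hs, ht]
    | tmul b c => rw [h2, sliceSnd_tmul]

/-- The counit. -/
noncomputable def counit : A →ₗ[ℂ] ℂ := Q.exists_counit.choose

lemma mul'_T₁_symm (t : A ⊗[ℂ] A) :
    LinearMap.mul' ℂ A (Q.T₁.symm t) = sliceFst Q.counit t := Q.exists_counit.choose_spec.1 t

lemma mul'_T₂_symm (t : A ⊗[ℂ] A) :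
    LinearMap.mul' ℂ A (Q.T₂.symm t) = sliceSnd Q.counit t := Q.exists_counit.choose_spec.2 t

lemma sliceFst_counit_T₁ (t : A ⊗[ℂ] A) :
    sliceFst Q.counit (Q.T₁ t) = LinearMap.mul' ℂ A t := by
  rw [← mul'_T₁_symm, LinearEquiv.symm_apply_apply]

lemma sliceSnd_counit_T₂ (t : A ⊗[ℂ] A) :
    sliceSnd Q.counit (Q.T₂ t) = LinearMap.mul' ℂ A t := by
  rw [← mul'_T₂_symm, LinearEquiv.symm_apply_apply]

lemma isCounit_counit : Q.IsCounit Q.counit :=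
  ⟨fun a b => Q.sliceFst_counit_T₁ (a ⊗ₜ[ℂ] b), fun a b => Q.sliceSnd_counit_T₂ (a ⊗ₜ[ℂ] b)⟩

lemma eq_counit {ε : A →ₗ[ℂ] ℂ} (h : Q.IsCounit ε) : ε = Q.counit := by
  obtain ⟨c, hc⟩ := Q.exists_φ_eq_one
  have h1 : ∀ t, sliceFst ε (Q.T₁ t) = LinearMap.mul' ℂ A t := by
    intro t
    induction t using TensorProduct.induction_on with
    | zero => simp
    | add s t hs ht => simp only [map_add, hs, ht]
    | tmul a b => exact h.1 a b
  ext a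
  have h2 := h1 (Q.T₁.symm (a ⊗ₜ[ℂ] c))
  rw [← sliceFst_counit_T₁, LinearEquiv.apply_symm_apply, sliceFst_tmul, sliceFst_tmul] at h2
  simpa [hc] using congrArg Q.φ h2

/-- If ε vanished, all products in A would vanish. -/
lemma exists_counit_eq_one : ∃ a, Q.counit a = 1 := by
  obtain ⟨c, hc⟩ := Q.exists_φ_eq_one
  have : Q.counit ≠ 0 := by
    intro h
    have h0 : ∀ t, LinearMap.mul' ℂ A t = 0 := fun t => by
      rw [← sliceFst_counit_T₁, h]
      simp [sliceFst]
    have : c = 0 := Q.nondeg_left c fun x => h0 (x ⊗ₜ[ℂ] c)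
    simp [this] at hc
  obtain ⟨a, ha⟩ := DFunLike.ne_iff.1 this
  exact ⟨(Q.counit a)⁻¹ • a, by simpa using inv_mul_cancel₀ ha⟩

/-- If `T₁⁻¹(a ⊗ c) = ∑ aᵢ ⊗ cᵢ` then `T₁⁻¹(ab ⊗ c) = ∑ (aᵢ ⊗ 1) T₁⁻¹(b ⊗ cᵢ)`. -/
lemma T₁_symm_mul (a b c : A) : Q.T₁.symm ((a * b) ⊗ₜ[ℂ] c) =
    TensorProduct.lift ((LinearMap.mk₂ ℂ fun x y : A =>
      rTensor A (mulLeft ℂ x) (Q.T₁.symm (b ⊗ₜ[ℂ] y)))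
      (fun x x' y => by
        rw [show mulLeft ℂ (x + x') = mulLeft ℂ x + mulLeft ℂ x' from map_add (LinearMap.mul ℂ A) x x',
          LinearMap.rTensor_add, LinearMap.add_apply])
      (fun r x y => by
        rw [show mulLeft ℂ (r • x) = r • mulLeft ℂ x from map_smul (LinearMap.mul ℂ A) r x,
          LinearMap.rTensor_smul, LinearMap.smul_apply])
      (fun x y y' => by simp [TensorProduct.tmul_add])
      (fun r x y => by simp)) (Q.T₁.symm (a ⊗ₜ[ℂ] c)) := by
  rw [LinearEquiv.symm_apply_eq]
  have h1 : ∀ (x : A) (t : A ⊗[ℂ] A), Q.T₁ (rTensor A (mulLeft ℂ x) t) = (Q.Δ x).left (Q.T₁ t) := by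
    intro x t
    induction t using TensorProduct.induction_on with
    | zero => simp
    | add s t hs ht => simp only [map_add, hs, ht]
    | tmul a b => simp [T₁_mul_left]
  have h2 : (a * b) ⊗ₜ[ℂ] c = rTensor A (mulRight ℂ b) (Q.T₁ (Q.T₁.symm (a ⊗ₜ[ℂ] c))) := by simp
  rw [h2]
  generalize Q.T₁.symm (a ⊗ₜ[ℂ] c) = t
  induction t using TensorProduct.induction_on with
  | zero => simp
  | add s t hs ht => simp only [map_add, hs, ht]
  | tmul x y => simp [h1, Δ_left_tmul]

/-- Multiplying the legs of T₁⁻¹(ab ⊗ c) gives ε(ab)c; through `T₁_symm_mul` the factors for b and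
for a come out one after the other. -/
lemma counit_mul (a b : A) : Q.counit (a * b) = Q.counit a * Q.counit b := by
  obtain ⟨c, hc⟩ := Q.exists_φ_eq_one
  have h1 : Q.counit (a * b) • c = Q.counit b • Q.counit a • c := by
    rw [← sliceFst_tmul, ← mul'_T₁_symm, T₁_symm_mul, ← sliceFst_tmul Q.counit a, ← mul'_T₁_symm]
    generalize Q.T₁.symm (a ⊗ₜ[ℂ] c) = t
    induction t using TensorProduct.induction_on with
    | zero => simp
    | add s t hs ht => simp only [map_add, hs, ht, smul_add]
    | tmul x y =>
      have h2 : ∀ t : A ⊗[ℂ] A, LinearMap.mul' ℂ A (rTensor A (mulLeft ℂ x) t) =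
          x * LinearMap.mul' ℂ A t := by
        intro t
        induction t using TensorProduct.induction_on with
        | zero => simp
        | add s t hs ht => simp only [map_add, hs, ht, mul_add]
        | tmul x y => simp [mul_assoc]
      simp [h2, mul'_T₁_symm, mul_smul_comm]
  simpa [hc, mul_comm] using congrArg Q.φ h1

/-! ### The antipode -/

lemma lTensor_counit_T₁leg (t : A ⊗[ℂ] (A ⊗[ℂ] A)) :
    lTensor A (sliceFst Q.counit) (Q.T₁leg t) = lTensor A (LinearMap.mul' ℂ A) t := by
  induction t using TensorProduct.induction_on with
  | zero => simp
  | add s t hs ht => simp only [map_add, hs, ht]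
  | tmul a w => simp [T₁leg_tmul, sliceFst_counit_T₁]

lemma lTensor_counit_T₂leg (a b c : A) :
    lTensor A (sliceFst Q.counit) (Q.T₂leg (a ⊗ₜ[ℂ] (b ⊗ₜ[ℂ] c))) = (a * b) ⊗ₜ[ℂ] c := by
  rw [T₂leg_tmul, lTensor_sliceFst_assoc, sliceSnd_counit_T₂]
  simp

/-- `a ⊗ b ↦ S(a)b`. -/
noncomputable def antipodeMul : A ⊗[ℂ] A →ₗ[ℂ] A := sliceFst Q.counit ∘ₗ Q.T₁.symm.toLinearMap

/-- `a ⊗ b ↦ aS(b)`. -/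
noncomputable def mulAntipode : A ⊗[ℂ] A →ₗ[ℂ] A := sliceSnd Q.counit ∘ₗ Q.T₂.symm.toLinearMap

lemma antipodeMul_apply (t : A ⊗[ℂ] A) : Q.antipodeMul t = sliceFst Q.counit (Q.T₁.symm t) := rfl

lemma mulAntipode_apply (t : A ⊗[ℂ] A) : Q.mulAntipode t = sliceSnd Q.counit (Q.T₂.symm t) := rfl

lemma lTensor_counit_T₂leg_symm (d : A) (w : A ⊗[ℂ] A) :
    lTensor A (sliceFst Q.counit) (Q.T₂leg.symm (d ⊗ₜ[ℂ] w)) =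
      rTensor A (Q.mulAntipode ∘ₗ TensorProduct.mk ℂ A A d) w := by
  induction w using TensorProduct.induction_on with
  | zero => simp
  | add s t hs ht => simp only [map_add, TensorProduct.tmul_add, hs, ht]
  | tmul b c =>
    rw [← TensorProduct.assoc_tmul, T₂leg_symm_assoc, lTensor_sliceFst_assoc]
    simp [mulAntipode_apply]

/-- This is (aS(b))c = a(S(b)c), so S(b) is at least a multiplier. If a ⊗ b ⊗ c is obtained from u
by T₁ and T₂ on adjacent legs, each side cancels one of the two, the counit removes the other, and
both become the product of the three legs of u. -/
lemma mulAntipode_mul (a b c : A) :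
    Q.mulAntipode (a ⊗ₜ[ℂ] b) * c = a * Q.antipodeMul (b ⊗ₜ[ℂ] c) := by
  have h1 : ∀ t, LinearMap.mul' ℂ A (lTensor A Q.antipodeMul t) =
      LinearMap.mul' ℂ A (lTensor A (sliceFst Q.counit) (Q.T₁leg.symm t)) := by
    intro t
    induction t using TensorProduct.induction_on with
    | zero => simp
    | add s t hs ht => simp only [map_add, hs, ht]
    | tmul a w => simp [T₁leg_symm_tmul, antipodeMul_apply]
  have h2 : Q.mulAntipode (a ⊗ₜ[ℂ] b) * c =
      LinearMap.mul' ℂ A (lTensor A (sliceFst Q.counit) (Q.T₂leg.symm (a ⊗ₜ[ℂ] (b ⊗ₜ[ℂ] c)))) := by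
    simp [lTensor_counit_T₂leg_symm]
  have h3 : a * Q.antipodeMul (b ⊗ₜ[ℂ] c) =
      LinearMap.mul' ℂ A (lTensor A Q.antipodeMul (a ⊗ₜ[ℂ] (b ⊗ₜ[ℂ] c))) := by simp
  obtain ⟨u, hu⟩ : ∃ u, a ⊗ₜ[ℂ] (b ⊗ₜ[ℂ] c) = Q.T₂leg (Q.T₁leg u) :=
    ⟨Q.T₁leg.symm (Q.T₂leg.symm (a ⊗ₜ[ℂ] (b ⊗ₜ[ℂ] c))), by simp⟩
  rw [h2, h3, h1, hu, LinearEquiv.symm_apply_apply, T₂leg_T₁leg, LinearEquiv.symm_apply_apply,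
    lTensor_counit_T₁leg]
  clear hu h1 h2 h3
  induction u using TensorProduct.induction_on with
  | zero => simp
  | add s t hs ht => simp only [map_add, hs, ht]
  | tmul a w =>
    induction w using TensorProduct.induction_on with
    | zero => simp
    | add s t hs ht => simp only [map_add, TensorProduct.tmul_add, hs, ht]
    | tmul b c => simp [lTensor_counit_T₂leg, mul_assoc]

/-- The slice `(ι ⊗ φ)(tΔ(b))` for `t = ∑ (cᵢ ⊗ 1)Δ(aᵢ)` is `∑ φ(aᵢb)cᵢ`. -/
lemma sliceSnd_φ_Δ_right (b : A) (u : A ⊗[ℂ] A) :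
    sliceSnd Q.φ ((Q.Δ b).right (Q.T₂ u)) = sliceSnd (Q.φ ∘ₗ mulRight ℂ b) u := by
  induction u using TensorProduct.induction_on with
  | zero => simp
  | add s t hs ht => simp only [map_add, hs, ht]
  | tmul c a =>
    rw [← T₂_mul_right, sliceSnd_apply, Q.φ_left_invariant]
    simp

lemma mul_sliceSnd_φ_T₄ (a b c : A) : c * sliceSnd Q.φ (Q.T₄ (b ⊗ₜ[ℂ] a)) =
    sliceSnd (Q.φ ∘ₗ mulRight ℂ b) (Q.T₂.symm (c ⊗ₜ[ℂ] a)) := by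
  rw [← sliceSnd_φ_Δ_right, LinearEquiv.apply_symm_apply, Δ_right_tmul, T₂_T₄, sliceSnd_rTensor]
  rfl

/-- Apply ι ⊗ ε ⊗ ι to the commutation of `T₂leg.symm` with `T₁leg` at d ⊗ x ⊗ e. The result is
T₂⁻¹(d ⊗ x) = dS(x₍₁₎) ⊗ x₍₂₎, covered by e. -/
lemma lTensor_mulRight_T₂_symm (d x e : A) :
    lTensor A (mulRight ℂ e) (Q.T₂.symm (d ⊗ₜ[ℂ] x)) =
      rTensor A (Q.mulAntipode ∘ₗ TensorProduct.mk ℂ A A d) (Q.T₁ (x ⊗ₜ[ℂ] e)) := by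
  rw [← lTensor_counit_T₂leg_symm, ← T₁leg_tmul, T₂leg_symm_T₁leg, lTensor_counit_T₁leg,
    ← TensorProduct.assoc_tmul, T₂leg_symm_assoc, lTensor_mul'_assoc]

/-- The formula S((ι ⊗ φ)(Δ(a)(1 ⊗ b))) = (ι ⊗ φ)((1 ⊗ a)Δ(b)), a consequence of left invariance.
Its right-hand side lies in A and the slices on the left exhaust A, so S maps A to A. -/
lemma mulAntipode_sliceSnd (c : A) (t : A ⊗[ℂ] A) :
    Q.mulAntipode (c ⊗ₜ[ℂ] sliceSnd Q.φ (Q.T₁ t)) =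
      c * sliceSnd Q.φ (Q.T₄ (TensorProduct.comm ℂ A A t)) := by
  induction t using TensorProduct.induction_on with
  | zero => simp
  | add s t hs ht => simp only [map_add, TensorProduct.tmul_add, mul_add, hs, ht]
  | tmul a b =>
    rw [TensorProduct.comm_tmul, mul_sliceSnd_φ_T₄, ← sliceSnd_lTensor, lTensor_mulRight_T₂_symm,
      sliceSnd_rTensor]
    rfl

/-- The antipode as a linear map. -/
noncomputable def antipodeFun : A →ₗ[ℂ] A :=
  -- Since φ is 1 on the chosen c, the element a is the φ-slice of T₁(T₁⁻¹(a ⊗ c)), and the slice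
  -- formula dictates S(a).
  sliceSnd Q.φ ∘ₗ Q.T₄.toLinearMap ∘ₗ (TensorProduct.comm ℂ A A).toLinearMap ∘ₗ
    Q.T₁.symm.toLinearMap ∘ₗ (TensorProduct.mk ℂ A A).flip Q.exists_φ_eq_one.choose

lemma mul_antipodeFun (c a : A) : c * Q.antipodeFun a = Q.mulAntipode (c ⊗ₜ[ℂ] a) := by
  have : a = sliceSnd Q.φ (Q.T₁ (Q.T₁.symm (a ⊗ₜ[ℂ] Q.exists_φ_eq_one.choose))) := by
    simp [Q.exists_φ_eq_one.choose_spec]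
  conv_rhs => rw [this]
  rw [mulAntipode_sliceSnd]
  rfl

lemma antipodeFun_mul (a b : A) : Q.antipodeFun a * b = Q.antipodeMul (a ⊗ₜ[ℂ] b) := by
  apply Q.eq_of_forall_mul
  intro c
  rw [← mulAntipode_mul, ← mul_antipodeFun, mul_assoc]

lemma antipodeFun_sliceSnd (t : A ⊗[ℂ] A) : Q.antipodeFun (sliceSnd Q.φ (Q.T₁ t)) =
    sliceSnd Q.φ (Q.T₄ (TensorProduct.comm ℂ A A t)) := by
  apply Q.eq_of_forall_mul
  intro c
  rw [mul_antipodeFun, mulAntipode_sliceSnd]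

lemma exists_sliceSnd_φ_T₁ (a : A) : ∃ t, sliceSnd Q.φ (Q.T₁ t) = a := by
  obtain ⟨c, hc⟩ := Q.exists_φ_eq_one
  exact ⟨Q.T₁.symm (a ⊗ₜ[ℂ] c), by simp [hc]⟩

/-- Polarizing positivity gives the identity on products y*x. Products span A, because a = m(T₁⁻¹(c
⊗ a)) when ε(c) = 1. -/
lemma φ_star (a : A) : Q.φ (star a) = star (Q.φ a) := by
  have key : ∀ x y : A, Q.φ (star y * x) = star (Q.φ (star x * y)) := by
    intro x y
    have h1 := (Q.φ_pos (x + y)).2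
    have h2 := (Q.φ_pos (x + Complex.I • y)).2
    have hx := (Q.φ_pos x).2
    have hy := (Q.φ_pos y).2
    simp only [star_add, star_smul, add_mul, mul_add, map_add, smul_mul_assoc, mul_smul_comm,
      map_smul, smul_eq_mul, Complex.add_im, Complex.mul_im, Complex.mul_re, RCLike.star_def,
      Complex.conj_I, Complex.neg_re, Complex.neg_im, Complex.I_re, Complex.I_im] at h1 h2
    apply Complex.ext
    · simp only [RCLike.star_def, Complex.conj_re]
      linarith
    · simp only [RCLike.star_def, Complex.conj_im]
      linarith
  obtain ⟨c, hc⟩ := Q.exists_counit_eq_one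
  have : a = LinearMap.mul' ℂ A (Q.T₁.symm (c ⊗ₜ[ℂ] a)) := by simp [mul'_T₁_symm, hc]
  rw [this]
  generalize Q.T₁.symm (c ⊗ₜ[ℂ] a) = t
  induction t using TensorProduct.induction_on with
  | zero => simp
  | add s t hs ht => simp only [map_add, star_add, hs, ht]
  | tmul x y => simpa using key (star x) y

lemma sliceSnd_φ_star (t : A ⊗[ℂ] A) : sliceSnd Q.φ (star t) = star (sliceSnd Q.φ t) := by
  induction t using TensorProduct.induction_on with
  | zero => simp
  | add s t hs ht => simp only [map_add, star_add, hs, ht]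
  | tmul x y => simp [TensorProduct.star_tmul, φ_star, star_smul]

/-- The slice formula for S exchanges T₁ with T₄, and so does the involution; doing both twice
returns to the start. This yields the inverse of S. -/
lemma antipodeFun_star (a : A) : Q.antipodeFun (star (Q.antipodeFun a)) = star a := by
  obtain ⟨t, rfl⟩ := Q.exists_sliceSnd_φ_T₁ a
  rw [antipodeFun_sliceSnd, T₄_apply, sliceSnd_φ_star, star_star, antipodeFun_sliceSnd, T₄_apply,
    comm_star, star_star, sliceSnd_φ_star]
  congr 4
  exact (TensorProduct.comm ℂ A A).symm_apply_apply t

/-- The antipode. -/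
noncomputable def antipode : A ≃ₗ[ℂ] A where
  __ := Q.antipodeFun
  invFun a := star (Q.antipodeFun (star a))
  left_inv a := by
    change star (Q.antipodeFun (star (Q.antipodeFun a))) = a
    rw [antipodeFun_star, star_star]
  right_inv a := by
    change Q.antipodeFun (star (Q.antipodeFun (star a))) = a
    rw [antipodeFun_star, star_star]

lemma antipode_symm_apply (a : A) : Q.antipode.symm a = star (Q.antipode (star a)) := rfl

lemma mul_antipode (c a : A) : c * Q.antipode a = Q.mulAntipode (c ⊗ₜ[ℂ] a) :=
  Q.mul_antipodeFun c a

lemma antipode_mul' (a b : A) : Q.antipode a * b = Q.antipodeMul (a ⊗ₜ[ℂ] b) :=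
  Q.antipodeFun_mul a b

lemma antipode_sliceSnd (a b : A) : Q.antipode (sliceSnd Q.φ (Q.T₁ (a ⊗ₜ[ℂ] b))) =
    sliceSnd Q.φ (Q.T₄ (b ⊗ₜ[ℂ] a)) :=
  Q.antipodeFun_sliceSnd (a ⊗ₜ[ℂ] b)

lemma mul'_rTensor_antipode (t : A ⊗[ℂ] A) :
    LinearMap.mul' ℂ A (rTensor A Q.antipode.toLinearMap t) = Q.antipodeMul t := by
  induction t using TensorProduct.induction_on with
  | zero => simp
  | add s t hs ht => simp only [map_add, hs, ht]
  | tmul x y => simp [antipode_mul']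

lemma mul'_lTensor_antipode (t : A ⊗[ℂ] A) :
    LinearMap.mul' ℂ A (lTensor A Q.antipode.toLinearMap t) = Q.mulAntipode t := by
  induction t using TensorProduct.induction_on with
  | zero => simp
  | add s t hs ht => simp only [map_add, hs, ht]
  | tmul x y => simp [mul_antipode]

lemma isAntipode_antipode : Q.IsAntipode Q.antipode := by
  refine ⟨Q.counit, Q.isCounit_counit, fun a b => ?_, fun a b => ?_⟩
  · rw [mul'_rTensor_antipode, antipodeMul_apply]
    simp
  · rw [mul'_lTensor_antipode, mulAntipode_apply]
    simp

lemma eq_antipode {S : A ≃ₗ[ℂ] A} (h : Q.IsAntipode S) : S = Q.antipode := by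
  obtain ⟨ε, hε, h1, -⟩ := h
  obtain rfl := Q.eq_counit hε
  have h2 : ∀ t, LinearMap.mul' ℂ A (rTensor A S.toLinearMap (Q.T₁ t)) = sliceFst Q.counit t := by
    intro t
    induction t using TensorProduct.induction_on with
    | zero => simp
    | add s t hs ht => simp only [map_add, hs, ht]
    | tmul x y => rw [h1, sliceFst_tmul]
  ext a
  apply Q.eq_of_forall_mul_right
  intro b
  rw [antipode_mul', antipodeMul_apply, ← h2, LinearEquiv.apply_symm_apply]
  simp

/-- As for ε, `T₁_symm_mul` expands T₁⁻¹(ab ⊗ c); now ε is applied to the first leg, where it is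
multiplicative. -/
lemma antipode_mul (a b : A) : Q.antipode (a * b) = Q.antipode b * Q.antipode a := by
  apply Q.eq_of_forall_mul_right
  intro c
  rw [antipode_mul', antipodeMul_apply, T₁_symm_mul, mul_assoc, antipode_mul' _ a,
    antipodeMul_apply]
  generalize Q.T₁.symm (a ⊗ₜ[ℂ] c) = t
  induction t using TensorProduct.induction_on with
  | zero => simp
  | add s t hs ht => simp only [map_add, hs, ht, mul_add]
  | tmul x y =>
    have : Q.counit ∘ₗ mulLeft ℂ x = Q.counit x • Q.counit := by
      ext z
      simp [counit_mul]
    have h2 : ∀ t : A ⊗[ℂ] A, sliceFst (Q.counit x • Q.counit) t =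
        Q.counit x • sliceFst Q.counit t := by
      intro t
      simp [sliceFst, LinearMap.rTensor_smul]
    simp [sliceFst_rTensor, this, h2, mul_smul_comm, antipode_mul', antipodeMul_apply]

lemma lTensor_mulLeft_T₂_symm (d x b : A) :
    lTensor A (mulLeft ℂ b) (Q.T₂.symm (d ⊗ₜ[ℂ] x)) =
      rTensor A (mulLeft ℂ d ∘ₗ Q.antipode.toLinearMap) (Q.T₄ (x ⊗ₜ[ℂ] b)) := by
  have hd : mulLeft ℂ d ∘ₗ Q.antipode.toLinearMap = Q.mulAntipode ∘ₗ TensorProduct.mk ℂ A A d := by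
    ext y
    simp [mul_antipode]
  have hl : ∀ (b e : A) (t : A ⊗[ℂ] A), lTensor A (mulRight ℂ e) (lTensor A (mulLeft ℂ b) t) =
      lTensor A (mulLeft ℂ b) (lTensor A (mulRight ℂ e) t) := by
    intro b e t
    induction t using TensorProduct.induction_on with
    | zero => simp
    | add s t hs ht => simp only [map_add, hs, ht]
    | tmul x y => simp [mul_assoc]
  have hr : ∀ (f g : A →ₗ[ℂ] A) (t : A ⊗[ℂ] A), lTensor A g (rTensor A f t) =
      rTensor A f (lTensor A g t) := by
    intro f g t
    rw [← LinearMap.comp_apply, ← LinearMap.comp_apply, LinearMap.rTensor_comp_lTensor,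
      LinearMap.lTensor_comp_rTensor]
  apply Q.eq_of_lTensor_mulRight
  intro e
  rw [hl, lTensor_mulRight_T₂_symm, hr, hr, ← T₁_T₄, hd]

/-- `W(p ⊗ x)(1 ⊗ a) = S⁻¹(x₍₁₎)p ⊗ x₍₂₎a`. -/
lemma lTensor_mulRight_W (p x a : A) :
    lTensor A (mulRight ℂ a) (Q.W (p ⊗ₜ[ℂ] x)) =
      rTensor A (mulRight ℂ p ∘ₗ Q.antipode.symm.toLinearMap) (Q.T₁ (x ⊗ₜ[ℂ] a)) := by
  -- W is T₂⁻¹ conjugated by the involution, and S⁻¹ is S conjugated by it, so the formula for T₂⁻¹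
  -- transfers.
  have h1 : Q.W (p ⊗ₜ[ℂ] x) = star (Q.T₂.symm (star (p ⊗ₜ[ℂ] x))) := rfl
  have h2 : ∀ t : A ⊗[ℂ] A,
      star (rTensor A (mulLeft ℂ (star p) ∘ₗ Q.antipode.toLinearMap) (star t)) =
        rTensor A (mulRight ℂ p ∘ₗ Q.antipode.symm.toLinearMap) t := by
    intro t
    induction t using TensorProduct.induction_on with
    | zero => simp
    | add s t hs ht => simp only [map_add, star_add, hs, ht]
    | tmul x y => simp [TensorProduct.star_tmul, antipode_symm_apply]
  apply star_injective
  rw [star_lTensor_mulRight, h1, star_star, TensorProduct.star_tmul, lTensor_mulLeft_T₂_symm,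
    ← h2, star_star, T₄_apply, TensorProduct.star_tmul, star_star, star_star]

/-- Coassociativity in the form `(T₂ ⊗ ι)(ι ⊗ T₄) = (ι ⊗ T₄)(T₂ ⊗ ι)`. -/
lemma T₂leg_T₄ (k d c : A) : Q.T₂leg (k ⊗ₜ[ℂ] Q.T₄ (d ⊗ₜ[ℂ] c)) =
    lTensor A (Q.T₄.toLinearMap ∘ₗ (TensorProduct.mk ℂ A A).flip c) (Q.T₂ (k ⊗ₜ[ℂ] d)) := by
  have h1 : ∀ (h : A →ₗ[ℂ] A) (t : A ⊗[ℂ] (A ⊗[ℂ] A)),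
      lTensor A (lTensor A h) (Q.T₂leg t) = Q.T₂leg (lTensor A (lTensor A h) t) := by
    intro h t
    induction t using TensorProduct.induction_on with
    | zero => simp
    | add s t hs ht => simp only [map_add, hs, ht]
    | tmul a w =>
      induction w using TensorProduct.induction_on with
      | zero => simp
      | add s t hs ht => simp only [map_add, TensorProduct.tmul_add, hs, ht]
      | tmul b c =>
        simp only [LinearMap.lTensor_tmul, T₂leg_tmul]
        generalize Q.T₂ (a ⊗ₜ[ℂ] b) = s
        induction s using TensorProduct.induction_on with
        | zero => simp
        | add s t hs ht => simp only [map_add, TensorProduct.add_tmul, hs, ht]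
        | tmul a b => simp
  have h2 : ∀ (e : A) (s : A ⊗[ℂ] A), Q.T₁leg (TensorProduct.assoc ℂ A A A (s ⊗ₜ[ℂ] e)) =
      lTensor A (Q.T₁.toLinearMap ∘ₗ (TensorProduct.mk ℂ A A).flip e) s := by
    intro e s
    induction s using TensorProduct.induction_on with
    | zero => simp
    | add s t hs ht => simp only [map_add, TensorProduct.add_tmul, hs, ht]
    | tmul a b => simp [T₁leg_tmul]
  -- Covering the third leg on the right exchanges T₄ with T₁, for which coassociativity is known.
  refine sub_eq_zero.1 <| tensor_eq_zero_of_lTensor (fun a : A => lTensor A (mulRight ℂ a))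
    (fun w hw => tensor_eq_zero_of_lTensor (fun a : A => mulRight ℂ a)
      (fun w hw => Q.nondeg_right w hw) w hw) _ fun e => ?_
  rw [map_sub, sub_eq_zero, h1, LinearMap.lTensor_tmul, ← T₁_T₄, ← LinearMap.lTensor_tmul, ← h1,
    ← T₁leg_tmul, T₂leg_T₁leg, T₂leg_tmul, h2, ← LinearMap.comp_apply, ← LinearMap.comp_apply,
    ← LinearMap.lTensor_comp, ← LinearMap.lTensor_comp]
  congr 2
  ext x
  simp [T₁_T₄]

/-! ### Faithfulness of the left integral -/

lemma mul_sliceSnd_φ_T₁ (k b x : A) : k * sliceSnd Q.φ (Q.T₁ (b ⊗ₜ[ℂ] x)) =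
    sliceSnd (Q.φ ∘ₗ mulRight ℂ x) (Q.T₂ (k ⊗ₜ[ℂ] b)) := by
  rw [← sliceSnd_lTensor, ← T₁_T₂, sliceSnd_rTensor]
  rfl

/-- The antipode takes (ι ⊗ φ)(Δ(b)(1 ⊗ x)), which vanishes by hypothesis, to this slice. -/
lemma sliceSnd_φ_T₄_eq_zero {x : A} (hx : ∀ b, Q.φ (b * x) = 0) (b : A) :
    sliceSnd Q.φ (Q.T₄ (x ⊗ₜ[ℂ] b)) = 0 := by
  have h : sliceSnd Q.φ (Q.T₁ (b ⊗ₜ[ℂ] x)) = 0 := by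
    apply Q.nondeg_left
    intro k
    rw [mul_sliceSnd_φ_T₁, show Q.φ ∘ₗ mulRight ℂ x = 0 from LinearMap.ext hx]
    simp [sliceSnd]
  rw [← antipode_sliceSnd, h, map_zero]

/-- The hypothesis says that a ↦ φ(· a) kills the second leg of t, and φ ∘ m factors through that
map. -/
lemma φ_mul'_eq_zero {t : A ⊗[ℂ] A} (ht : ∀ b, sliceSnd (Q.φ ∘ₗ mulLeft ℂ b) t = 0) :
    Q.φ (LinearMap.mul' ℂ A t) = 0 := by
  have h1 : lTensor A Q.fourierFun t = 0 := by
    refine tensor_eq_zero_of_lTensor (fun b : A => LinearMap.applyₗ (R := ℂ) (M₂ := ℂ) b)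
      (fun w hw => LinearMap.ext hw) _ fun b => ?_
    apply (TensorProduct.rid ℂ A).injective
    rw [map_zero, ← ht b, ← LinearMap.comp_apply, ← LinearMap.lTensor_comp]
    rfl
  have h2 : Q.φ (LinearMap.mul' ℂ A t) =
      TensorProduct.lift (LinearMap.applyₗ (R := ℂ) (M₂ := ℂ)) (lTensor A Q.fourierFun t) := by
    clear ht h1
    induction t using TensorProduct.induction_on with
    | zero => simp
    | add s t hs ht => simp only [map_add, hs, ht]
    | tmul x y => simp [fourierFun_apply]
  rw [h2, h1, map_zero]

/-- For t = T₂⁻¹(d ⊗ x) the slices (ι ⊗ φ)((1 ⊗ b)t) = dS((ι ⊗ φ)((1 ⊗ b)Δ(x))) vanish, while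
φ(m(t)) = ε(x)φ(d). -/
lemma counit_eq_zero {x : A} (hx : ∀ b, Q.φ (b * x) = 0) : Q.counit x = 0 := by
  obtain ⟨d, hd⟩ := Q.exists_φ_eq_one
  have h := Q.φ_mul'_eq_zero (t := Q.T₂.symm (d ⊗ₜ[ℂ] x)) fun b => by
    rw [← sliceSnd_lTensor, lTensor_mulLeft_T₂_symm, sliceSnd_rTensor,
      Q.sliceSnd_φ_T₄_eq_zero hx, map_zero]
  simpa [mul'_T₂_symm, hd] using h

/-- The left integral is faithful. -/
lemma φ_faithful {x : A} (hx : ∀ b, Q.φ (b * x) = 0) : x = 0 := by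
  apply Q.nondeg_left
  intro c
  refine (Module.forall_dual_apply_eq_zero_iff ℂ _).1 fun f => ?_
  -- f(cx) is ε of the slice (f ⊗ ι)((c ⊗ 1)Δ(x)), and this slice is again annihilated by every φ(b
  -- ·).
  rw [← LinearMap.mul'_apply (R := ℂ), ← sliceSnd_counit_T₂, sliceFst_sliceSnd]
  apply counit_eq_zero
  intro b
  have h : (Q.φ ∘ₗ mulLeft ℂ b) (sliceFst f (Q.T₂ (c ⊗ₜ[ℂ] x))) = 0 := by
    rw [← sliceFst_sliceSnd, ← sliceSnd_lTensor, T₂_T₄, sliceSnd_rTensor,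
      Q.sliceSnd_φ_T₄_eq_zero hx, map_zero, map_zero]
  exact h

lemma fourier_bijective : Function.Bijective Q.fourier := by
  refine ⟨(injective_iff_map_eq_zero _).2 fun a ha => Q.φ_faithful fun b => ?_,
    Q.fourier_surjective⟩
  rw [← ev_fourier, ha, map_zero, LinearMap.zero_apply]

/-! ### A right integral -/

lemma sliceR_fourier (d x : A) : Q.sliceR (Q.fourier d) x = sliceSnd Q.φ (Q.T₁ (x ⊗ₜ[ℂ] d)) := by
  apply Q.eq_of_forall_mul
  intro a
  rw [mul_sliceSnd_φ_T₁, mul_sliceR]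
  rfl

/-- A left invariant functional, with the second leg covered by the opposite side. -/
lemma sliceSnd_V {f : A →ₗ[ℂ] ℂ} (hf : ∀ a x, sliceSnd f (Q.T₂ (a ⊗ₜ[ℂ] x)) = f x • a)
    (t : A ⊗[ℂ] A) : sliceSnd f (Q.V t) = sliceSnd f t := by
  induction t using TensorProduct.induction_on with
  | zero => simp
  | add s t hs ht => simp only [map_add, hs, ht]
  | tmul q p =>
    apply Q.eq_of_forall_mul
    intro a
    rw [← LinearMap.mulLeft_apply ℂ a, ← sliceSnd_rTensor, V_T₂, sliceSnd_rTensor, hf]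
    simp [mul_smul_comm]

lemma sliceSnd_W {f : A →ₗ[ℂ] ℂ} (hf : ∀ a x, sliceSnd f (Q.T₂ (a ⊗ₜ[ℂ] x)) = f x • a)
    (t : A ⊗[ℂ] A) : sliceSnd f (Q.W t) = sliceSnd f t := by
  rw [← Q.sliceSnd_V hf, W, LinearEquiv.apply_symm_apply]

lemma sliceSnd_φ_Δ_left_V (x : A) (u : A ⊗[ℂ] A) :
    sliceSnd Q.φ ((Q.Δ x).left (Q.V u)) = sliceSnd (Q.φ ∘ₗ mulLeft ℂ x) u := by
  induction u using TensorProduct.induction_on with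
  | zero => simp
  | add s t hs ht => simp only [map_add, hs, ht]
  | tmul q p =>
    rw [← V_mul_right, Q.sliceSnd_V Q.φ_left_invariant]
    simp

/-- If W(p ⊗ c) = ∑ pᵢ ⊗ cᵢ, then Δ(x)(p ⊗ c) = ∑ Δ(xcᵢ)(pᵢ ⊗ 1), and left invariance gives ∑
φ(xcᵢ)pᵢ: an operator of finite rank in x. -/
lemma sliceR_fourier_mul (c x p : A) : Q.sliceR (Q.fourier c) x * p =
    sliceSnd (Q.φ ∘ₗ mulLeft ℂ x) (Q.W (p ⊗ₜ[ℂ] c)) := by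
  rw [← sliceSnd_φ_Δ_left_V, W, LinearEquiv.apply_symm_apply, Δ_left_tmul, sliceSnd_rTensor,
    ← sliceR_fourier]
  rfl

/-- `(b ⊗ d) ↦ (z ↦ φ(zd)b)`. -/
noncomputable def rankOne : A ⊗[ℂ] A →ₗ[ℂ] A →ₗ[ℂ] A :=
  TensorProduct.lift (LinearMap.smulRightₗ ∘ₗ Q.fourierFun).flip

lemma rankOne_apply (w : A ⊗[ℂ] A) (z : A) :
    Q.rankOne w z = sliceSnd (Q.φ ∘ₗ mulLeft ℂ z) w := by
  induction w using TensorProduct.induction_on with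
  | zero => simp
  | add s t hs ht => simp only [map_add, LinearMap.add_apply, hs, ht]
  | tmul x y => simp [rankOne, fourierFun_apply]

/-- Both sides are c₍₁₎ ⊗ c₍₂₎bφ(c₍₃₎d). By `sliceR_fourier_mul` the operator z ↦ z₍₁₎bφ(z₍₂₎d) has
finite rank, so one coproduct of c remains. -/
lemma T₁_sliceR_fourier (b c d : A) : Q.T₁ (Q.sliceR (Q.fourier d) c ⊗ₜ[ℂ] b) =
    rTensor A (sliceSnd Q.φ ∘ₗ Q.T₁.toLinearMap ∘ₗ TensorProduct.mk ℂ A A c)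
      (TensorProduct.comm ℂ A A (Q.W (b ⊗ₜ[ℂ] d))) := by
  apply Q.eq_of_rTensor_mulLeft
  intro k
  have h1 : mulRight ℂ b ∘ₗ Q.sliceR (Q.fourier d) = Q.rankOne (Q.W (b ⊗ₜ[ℂ] d)) := by
    ext z
    rw [rankOne_apply, ← sliceR_fourier_mul]
    rfl
  rw [T₁_T₂, T₂_sliceR, ← LinearMap.comp_apply, ← LinearMap.lTensor_comp, h1]
  generalize Q.W (b ⊗ₜ[ℂ] d) = w
  induction w using TensorProduct.induction_on with
  | zero => simp
  | add s t hs ht => simp only [map_add, LinearMap.lTensor_add, LinearMap.add_apply, hs, ht]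
  | tmul b d =>
    simp only [TensorProduct.comm_tmul, LinearMap.rTensor_tmul, LinearMap.comp_apply,
      LinearEquiv.coe_coe, TensorProduct.mk_apply, LinearMap.mulLeft_apply, mul_sliceSnd_φ_T₁]
    generalize Q.T₂ (k ⊗ₜ[ℂ] c) = s
    induction s using TensorProduct.induction_on with
    | zero => simp
    | add s t hs ht => simp only [map_add, TensorProduct.add_tmul, hs, ht]
    | tmul y z => simp [rankOne_apply, TensorProduct.tmul_smul, TensorProduct.smul_tmul']

/-- The right integral `φ ∘ S`. -/
noncomputable def ψ : A →ₗ[ℂ] ℂ := Q.φ ∘ₗ Q.antipode.toLinearMap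

lemma ψ_apply (a : A) : Q.ψ a = Q.φ (Q.antipode a) := rfl

lemma exists_ψ_eq_one : ∃ a, Q.ψ a = 1 := by
  obtain ⟨a, ha⟩ := Q.exists_φ_eq_one
  exact ⟨Q.antipode.symm a, by simp [ψ_apply, ha]⟩

/-- By the slice formula for S the functional in d is φ(d₍₁₎)φ(cd₍₂₎). As a convolution with φ as
first factor it is again left invariant. -/
lemma sliceSnd_ψ_sliceR_T₂ (c k d : A) :
    sliceSnd (Q.ψ ∘ₗ sliceSnd Q.φ ∘ₗ Q.T₁.toLinearMap ∘ₗ TensorProduct.mk ℂ A A c)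
      (Q.T₂ (k ⊗ₜ[ℂ] d)) = Q.ψ (sliceSnd Q.φ (Q.T₁ (c ⊗ₜ[ℂ] d))) • k := by
  have h1 : Q.ψ ∘ₗ sliceSnd Q.φ ∘ₗ Q.T₁.toLinearMap ∘ₗ TensorProduct.mk ℂ A A c =
      (Q.φ ∘ₗ sliceSnd Q.φ) ∘ₗ Q.T₄.toLinearMap ∘ₗ (TensorProduct.mk ℂ A A).flip c := by
    ext d
    simp [ψ_apply, antipode_sliceSnd]
  rw [h1, ← sliceSnd_lTensor, ← T₂leg_T₄, ψ_apply, antipode_sliceSnd]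
  generalize Q.T₄ (d ⊗ₜ[ℂ] c) = w
  induction w using TensorProduct.induction_on with
  | zero => simp
  | add s t hs ht => simp only [map_add, TensorProduct.tmul_add, add_smul, hs, ht]
  | tmul y z =>
    have h2 : Q.φ y • k = sliceSnd Q.φ (Q.T₂ (k ⊗ₜ[ℂ] y)) := (Q.φ_left_invariant k y).symm
    rw [T₂leg_tmul, sliceSnd_tmul, map_smul, smul_assoc, h2]
    generalize Q.T₂ (k ⊗ₜ[ℂ] y) = s
    induction s using TensorProduct.induction_on with
    | zero => simp
    | add s t hs ht => simp only [map_add, TensorProduct.add_tmul, smul_add, hs, ht]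
    | tmul y' z' => simp [smul_smul]

/-- Right invariance of `φ ∘ S`. -/
lemma sliceFst_ψ_T₁ (a b : A) : sliceFst Q.ψ (Q.T₁ (a ⊗ₜ[ℂ] b)) = Q.ψ a • b := by
  obtain ⟨t, rfl⟩ := Q.exists_sliceSnd_φ_T₁ a
  induction t using TensorProduct.induction_on with
  | zero => simp
  | add s t hs ht => simp only [map_add, TensorProduct.add_tmul, add_smul, hs, ht]
  | tmul c d =>
    have h : ∀ (f : A →ₗ[ℂ] ℂ) (t : A ⊗[ℂ] A),
        sliceFst f (TensorProduct.comm ℂ A A t) = sliceSnd f t := by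
      intro f t
      induction t using TensorProduct.induction_on with
      | zero => simp
      | add s t hs ht => simp only [map_add, hs, ht]
      | tmul x y => simp
    -- With W(b ⊗ d) = ∑ bᵢ ⊗ dᵢ the ψ-slice is ∑ f(dᵢ)bᵢ, where f is the left invariant functional
    -- of `sliceSnd_ψ_sliceR_T₂`; slicing W by such an f gives f(d)b.
    rw [← sliceR_fourier, T₁_sliceR_fourier, sliceFst_rTensor, h,
      Q.sliceSnd_W fun a x => Q.sliceSnd_ψ_sliceR_T₂ c a x, sliceR_fourier]
    simp

lemma sliceFst_ψ_Δ_left_T₁ (x : A) (u : A ⊗[ℂ] A) :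
    sliceFst Q.ψ ((Q.Δ x).left (Q.T₁ u)) = sliceFst (Q.ψ ∘ₗ mulLeft ℂ x) u := by
  induction u using TensorProduct.induction_on with
  | zero => simp
  | add s t hs ht => simp only [map_add, hs, ht]
  | tmul q p =>
    rw [← T₁_mul_left, sliceFst_ψ_T₁]
    simp

/-- Evaluate (ψ ⊗ φ)(Δ(x)Δ(q)(p ⊗ 1)) in both orders, with Δ(q)(p ⊗ 1) = ∑ Δ(rᵢ)(1 ⊗ sᵢ): left
invariance gives φ(xq)ψ(p), right invariance ∑ ψ(xrᵢ)φ(sᵢ). -/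
lemma exists_ψ_eq_φ (q : A) : ∃ c, ∀ x, Q.φ (x * q) = Q.ψ (x * c) := by
  obtain ⟨p, hp⟩ := Q.exists_ψ_eq_one
  refine ⟨sliceSnd Q.φ (Q.T₁.symm (Q.V (p ⊗ₜ[ℂ] q))), fun x => ?_⟩
  have h := sliceFst_sliceSnd Q.ψ Q.φ ((Q.Δ x).left (Q.V (p ⊗ₜ[ℂ] q)))
  rw [sliceSnd_φ_Δ_left_V, ← Q.T₁.apply_symm_apply (Q.V (p ⊗ₜ[ℂ] q)), sliceFst_ψ_Δ_left_T₁,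
    ← sliceFst_sliceSnd] at h
  simpa [hp] using h

lemma exists_φ_eq_ψ (r : A) : ∃ c, ∀ x, Q.ψ (x * r) = Q.φ (x * c) := by
  obtain ⟨p, hp⟩ := Q.exists_φ_eq_one
  refine ⟨sliceFst Q.ψ (Q.V.symm (Q.T₁ (r ⊗ₜ[ℂ] p))), fun x => ?_⟩
  have h := sliceFst_sliceSnd Q.ψ Q.φ ((Q.Δ x).left (Q.T₁ (r ⊗ₜ[ℂ] p)))
  rw [sliceFst_ψ_Δ_left_T₁, ← Q.V.apply_symm_apply (Q.T₁ (r ⊗ₜ[ℂ] p)), sliceSnd_φ_Δ_left_V,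
    sliceFst_sliceSnd] at h
  simpa [hp] using h.symm

/-! ### Modularity -/

lemma V_T₄ (x a c : A) : lTensor A (mulLeft ℂ a) (Q.V (c ⊗ₜ[ℂ] x)) =
    rTensor A (mulRight ℂ c) (Q.T₄ (x ⊗ₜ[ℂ] a)) := by
  apply Q.eq_of_forall_mul_tensor
  intro z
  rw [mul_lTensor_mulLeft, Q.mul_V, mul_rTensor_mulRight, mul_T₄]
  rfl

/-- `(ψ ⊗ ι)(Δ(x)(c ⊗ 1)) = S((ψ ⊗ ι)((x ⊗ 1)Δ(c)))`. -/
lemma sliceFst_ψ_V (c x : A) :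
    sliceFst Q.ψ (Q.V (c ⊗ₜ[ℂ] x)) = Q.antipode (sliceFst Q.ψ (Q.T₂ (x ⊗ₜ[ℂ] c))) := by
  apply Q.eq_of_forall_mul_right
  intro e
  have h1 : ∀ s : A ⊗[ℂ] A, Q.antipodeMul (sliceFst Q.ψ s ⊗ₜ[ℂ] e) =
      sliceFst Q.ψ (lTensor A (sliceFst Q.counit)
        (Q.T₁leg.symm (TensorProduct.assoc ℂ A A A (s ⊗ₜ[ℂ] e)))) := by
    intro s
    induction s using TensorProduct.induction_on with
    | zero => simp
    | add s t hs ht => simp only [map_add, TensorProduct.add_tmul, hs, ht]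
    | tmul y z => simp [T₁leg_symm_tmul, antipodeMul_apply, ← TensorProduct.smul_tmul']
  have h2 : ∀ w : A ⊗[ℂ] A, lTensor A (sliceFst Q.counit) (Q.T₂leg (x ⊗ₜ[ℂ] w)) =
      rTensor A (mulLeft ℂ x) w := by
    intro w
    induction w using TensorProduct.induction_on with
    | zero => simp
    | add s t hs ht => simp only [map_add, TensorProduct.tmul_add, hs, ht]
    | tmul y z => simp [lTensor_counit_T₂leg]
  -- With T₁⁻¹(c ⊗ e) = ∑ cᵢ ⊗ eᵢ both sides times e equal ∑ ψ(xcᵢ)eᵢ, one by coassociativity, the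
  -- other by right invariance.
  rw [antipode_mul', h1, ← T₂leg_tmul, T₁leg_symm_T₂leg, T₁leg_symm_tmul, h2, sliceFst_rTensor,
    ← sliceFst_ψ_Δ_left_T₁, LinearEquiv.apply_symm_apply, Δ_left_tmul', sliceFst_lTensor]
  rfl

/-- For t = k ⊗ a, evaluate (ψ ⊗ φ)((1 ⊗ a)Δ(x)(S(k) ⊗ 1)) in both orders. The slice formula for S
treats one order, `sliceFst_ψ_V` the other. -/
lemma φ_sliceFst_T₂_mul (t : A ⊗[ℂ] A) (x : A) :
    Q.φ (sliceFst (Q.ψ ∘ₗ Q.antipode.toLinearMap) (Q.T₂ t) * x) =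
      Q.ψ (x * sliceSnd Q.ψ (Q.T₁ (TensorProduct.map Q.antipode.toLinearMap
        Q.antipode.symm.toLinearMap t))) := by
  induction t using TensorProduct.induction_on with
  | zero => simp
  | add s t hs ht => simp only [map_add, add_mul, mul_add, hs, ht]
  | tmul k a =>
    have h1 := sliceFst_sliceSnd Q.ψ Q.φ (rTensor A (mulRight ℂ (Q.antipode k))
      (Q.T₄ (x ⊗ₜ[ℂ] a)))
    have h2 : Q.ψ (sliceSnd Q.φ (rTensor A (mulRight ℂ (Q.antipode k)) (Q.T₄ (x ⊗ₜ[ℂ] a)))) =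
        Q.φ (sliceFst (Q.ψ ∘ₗ Q.antipode.toLinearMap) (Q.T₂ (k ⊗ₜ[ℂ] a)) * x) := by
      have := sliceFst_sliceSnd (Q.ψ ∘ₗ Q.antipode.toLinearMap) (Q.φ ∘ₗ mulRight ℂ x)
        (Q.T₂ (k ⊗ₜ[ℂ] a))
      rw [← mul_sliceSnd_φ_T₁] at this
      rw [sliceSnd_rTensor, ← antipode_sliceSnd, LinearMap.mulRight_apply, ← antipode_mul]
      exact this
    have h3 : Q.φ (sliceFst Q.ψ (rTensor A (mulRight ℂ (Q.antipode k)) (Q.T₄ (x ⊗ₜ[ℂ] a)))) =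
        Q.ψ (x * sliceSnd Q.ψ (Q.T₁ (Q.antipode k ⊗ₜ[ℂ] Q.antipode.symm a))) := by
      have := sliceFst_sliceSnd (Q.ψ ∘ₗ mulLeft ℂ x) Q.ψ
        (Q.T₁ (Q.antipode k ⊗ₜ[ℂ] Q.antipode.symm a))
      rw [← sliceFst_rTensor, T₁_T₂, sliceFst_lTensor, ψ_apply _ (mulRight _ _ _), LinearMap.mulRight_apply,
        antipode_mul, LinearEquiv.apply_symm_apply] at this
      rw [← V_T₄, sliceFst_lTensor, sliceFst_ψ_V]
      exact this.symm
    rw [← h2, h1, h3]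
    simp

/-- `φ_sliceFst_T₂_mul` moves a to the other side of x at the price of replacing φ by ψ, and
`exists_φ_eq_ψ` returns to φ. The choice ψ(w) = 1 makes a one of the slices treated there. -/
lemma exists_ev_eq_φ_mul (a : A) : ∃ b : Q.Dual, ∀ x, Q.ev b x = Q.φ (a * x) := by
  obtain ⟨w, hw⟩ := Q.exists_ψ_eq_one
  let t := Q.T₂.symm (Q.antipode.symm w ⊗ₜ[ℂ] a)
  have ha : a = sliceFst (Q.ψ ∘ₗ Q.antipode.toLinearMap) (Q.T₂ t) := by simp [t, hw]
  obtain ⟨c, hc⟩ := Q.exists_φ_eq_ψ (sliceSnd Q.ψ (Q.T₁ (TensorProduct.map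
    Q.antipode.toLinearMap Q.antipode.symm.toLinearMap t)))
  refine ⟨Q.fourier c, fun x => ?_⟩
  rw [ev_fourier, ← hc, ← φ_sliceFst_T₂_mul, ← ha]

/-- The adjoint of the preceding lemma, as φ is hermitian. -/
lemma exists_φ_mul_eq_ev (b : Q.Dual) : ∃ a, ∀ x, Q.ev b x = Q.φ (a * x) := by
  obtain ⟨b', hb'⟩ := Q.exists_ev_eq_φ_mul (star (Q.density b))
  refine ⟨star (Q.density b'), fun x => ?_⟩
  have h := hb' (star x)
  rw [← star_mul, φ_star, ← Q.fourier_density b', ev_fourier] at h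
  rw [← Q.fourier_density b, ev_fourier, ← star_star (Q.φ (x * _)), ← h, ← φ_star, star_mul,
    star_star]

lemma exists_ψ_eq_ev (b : Q.Dual) : ∃ c, ∀ x, Q.ev b x = Q.ψ (x * c) := by
  obtain ⟨c, hc⟩ := Q.exists_ψ_eq_φ (Q.density b)
  exact ⟨c, fun x => by rw [← hc, ← ev_fourier, fourier_density]⟩

/-! ### Slices by elements of the dual -/

lemma eq_of_forall_ev {x y : A} (h : ∀ b, Q.ev b x = Q.ev b y) : x = y := by
  refine sub_eq_zero.1 (Q.φ_faithful fun a => ?_)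
  obtain ⟨b, hb⟩ := Q.exists_ev_eq_φ_mul a
  rw [← hb, map_sub, h, sub_self]

/-- The two legs of Δ(x) may be sliced in either order. With this, identities between slices become
associativity in B. -/
lemma ev_mul' (b b' : Q.Dual) (x : A) : Q.ev (b * b') x = Q.ev b' (Q.sliceL b x) := by
  rw [ev_mul, ← Q.fourier_density b', ev_fourier, sliceL_mul, sliceR_fourier]
  exact sliceFst_sliceSnd _ _ _

lemma sliceL_sliceR (b b' : Q.Dual) (x : A) :
    Q.sliceL b (Q.sliceR b' x) = Q.sliceR b' (Q.sliceL b x) := by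
  apply Q.eq_of_forall_ev
  intro c
  rw [← ev_mul', ← ev_mul, ← ev_mul, ← ev_mul', mul_assoc]

lemma sliceL_mul_dual (b b' : Q.Dual) (x : A) :
    Q.sliceL (b * b') x = Q.sliceL b' (Q.sliceL b x) := by
  apply Q.eq_of_forall_ev
  intro c
  rw [← ev_mul', ← ev_mul', ← ev_mul', mul_assoc]

/-- `b ↦ (ι ⊗ b)Δ` as a linear map. -/
noncomputable def sliceRₗ : Q.Dual →ₗ[ℂ] Module.End ℂ A where
  toFun := Q.sliceR
  map_add' := Q.sliceR_add
  map_smul' := Q.sliceR_smul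

/-- `b ↦ (b ⊗ ι)Δ` as a linear map. -/
noncomputable def sliceLₗ : Q.Dual →ₗ[ℂ] Module.End ℂ A where
  toFun := Q.sliceL
  map_add' b b' := by
    ext x
    apply Q.eq_of_forall_ev
    intro c
    rw [← ev_mul', add_mul, map_add, LinearMap.add_apply, LinearMap.add_apply, map_add, ev_mul',
      ev_mul']
  map_smul' r b := by
    ext x
    apply Q.eq_of_forall_ev
    intro c
    rw [← ev_mul', smul_mul_assoc, map_smul, LinearMap.smul_apply, RingHom.id_apply,
      LinearMap.smul_apply, map_smul, ev_mul']

/-! ### Slices and pairing on B ⊗ B. -/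

/-- `e ⊗ e' ↦ (x ⊗ x' ↦ x₍₁₎ ⊗ x'₍₁₎ ⟨x₍₂₎, e⟩⟨x'₍₂₎, e'⟩)`. -/
noncomputable def sliceR₂ : Q.Dual ⊗[ℂ] Q.Dual →ₗ[ℂ] (A ⊗[ℂ] A →ₗ[ℂ] A ⊗[ℂ] A) :=
  TensorProduct.homTensorHomMap (RingHom.id ℂ) A A A A ∘ₗ TensorProduct.map Q.sliceRₗ Q.sliceRₗ

/-- `e ⊗ e' ↦ (x ⊗ x' ↦ ⟨x₍₁₎, e⟩⟨x'₍₁₎, e'⟩ x₍₂₎ ⊗ x'₍₂₎)`. -/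
noncomputable def sliceL₂ : Q.Dual ⊗[ℂ] Q.Dual →ₗ[ℂ] (A ⊗[ℂ] A →ₗ[ℂ] A ⊗[ℂ] A) :=
  TensorProduct.homTensorHomMap (RingHom.id ℂ) A A A A ∘ₗ TensorProduct.map Q.sliceLₗ Q.sliceLₗ

lemma sliceR₂_tmul (e e' : Q.Dual) :
    Q.sliceR₂ (e ⊗ₜ[ℂ] e') = TensorProduct.map (Q.sliceR e) (Q.sliceR e') := by
  simp [sliceR₂, sliceRₗ]

lemma sliceL₂_tmul (e e' : Q.Dual) :
    Q.sliceL₂ (e ⊗ₜ[ℂ] e') = TensorProduct.map (Q.sliceL e) (Q.sliceL e') := by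
  simp [sliceL₂, sliceLₗ]

lemma ev₂_tmul (e e' : Q.Dual) (x x' : A) :
    Q.ev₂ (e ⊗ₜ[ℂ] e') (x ⊗ₜ[ℂ] x') = Q.ev e x * Q.ev e' x' := by
  simp [ev₂]

lemma ev₂_injective : Function.Injective Q.ev₂ := by
  refine (injective_iff_map_eq_zero _).2 fun s hs => ?_
  refine tensor_eq_zero_of_rTensor (fun x : A => Q.ev.flip x)
    (fun e he => Q.ev_injective <| LinearMap.ext fun x => by simpa using he x) s fun x => ?_
  apply (TensorProduct.lid ℂ Q.Dual).injective
  apply Q.ev_injective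
  ext x'
  have h : ∀ s, Q.ev (TensorProduct.lid ℂ Q.Dual (rTensor Q.Dual (Q.ev.flip x) s)) x' =
      Q.ev₂ s (x ⊗ₜ[ℂ] x') := by
    intro s
    induction s using TensorProduct.induction_on with
    | zero => simp
    | add s t hs ht => simp only [map_add, LinearMap.add_apply, hs, ht]
    | tmul e e' => simp [ev₂_tmul]
  rw [h, hs]
  simp

lemma ev₂_mul (s t : Q.Dual ⊗[ℂ] Q.Dual) : Q.ev₂ (s * t) = Q.ev₂ s ∘ₗ Q.sliceR₂ t := by
  induction s using TensorProduct.induction_on with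
  | zero => simp
  | add s s' hs hs' => simp only [add_mul, map_add, LinearMap.add_comp, hs, hs']
  | tmul b b' =>
    induction t using TensorProduct.induction_on with
    | zero => simp
    | add s s' hs hs' => simp only [mul_add, map_add, LinearMap.comp_add, hs, hs']
    | tmul e e' =>
      ext x x'
      simp [ev₂_tmul, sliceR₂_tmul, ev_mul]

lemma ev₂_mul' (s t : Q.Dual ⊗[ℂ] Q.Dual) : Q.ev₂ (s * t) = Q.ev₂ t ∘ₗ Q.sliceL₂ s := by
  induction s using TensorProduct.induction_on with
  | zero => simp
  | add s s' hs hs' => simp only [add_mul, map_add, LinearMap.comp_add, hs, hs']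
  | tmul b b' =>
    induction t using TensorProduct.induction_on with
    | zero => simp
    | add s s' hs hs' => simp only [mul_add, map_add, LinearMap.add_comp, hs, hs']
    | tmul e e' =>
      ext x x'
      simp [ev₂_tmul, sliceL₂_tmul, ev_mul']

lemma sliceR₂_mul (s t : Q.Dual ⊗[ℂ] Q.Dual) : Q.sliceR₂ (s * t) = Q.sliceR₂ s ∘ₗ Q.sliceR₂ t := by
  induction s using TensorProduct.induction_on with
  | zero => simp
  | add s s' hs hs' => simp only [add_mul, map_add, LinearMap.add_comp, hs, hs']
  | tmul b b' =>
    induction t using TensorProduct.induction_on with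
    | zero => simp
    | add s s' hs hs' => simp only [mul_add, map_add, LinearMap.comp_add, hs, hs']
    | tmul e e' =>
      ext x x'
      simp [sliceR₂_tmul, sliceR_mul]

lemma sliceL₂_mul (s t : Q.Dual ⊗[ℂ] Q.Dual) : Q.sliceL₂ (s * t) = Q.sliceL₂ t ∘ₗ Q.sliceL₂ s := by
  induction s using TensorProduct.induction_on with
  | zero => simp
  | add s s' hs hs' => simp only [add_mul, map_add, LinearMap.comp_add, hs, hs']
  | tmul b b' =>
    induction t using TensorProduct.induction_on with
    | zero => simp
    | add s s' hs hs' => simp only [mul_add, map_add, LinearMap.add_comp, hs, hs']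
    | tmul e e' =>
      ext x x'
      simp [sliceL₂_tmul, sliceL_mul_dual]

lemma sliceL₂_sliceR₂ (s t : Q.Dual ⊗[ℂ] Q.Dual) :
    Q.sliceL₂ s ∘ₗ Q.sliceR₂ t = Q.sliceR₂ t ∘ₗ Q.sliceL₂ s := by
  induction s using TensorProduct.induction_on with
  | zero => simp
  | add s s' hs hs' => simp only [map_add, LinearMap.comp_add, LinearMap.add_comp, hs, hs']
  | tmul b b' =>
    induction t using TensorProduct.induction_on with
    | zero => simp
    | add s s' hs hs' => simp only [map_add, LinearMap.comp_add, LinearMap.add_comp, hs, hs']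
    | tmul e e' =>
      ext x x'
      simp [sliceL₂_tmul, sliceR₂_tmul, sliceL_sliceR]

lemma sliceR₂_inr_left (b : Q.Dual) (t : Q.Dual ⊗[ℂ] Q.Dual) :
    Q.sliceR₂ ((MultiplierAlgebra.inr b).left t) = lTensor A (Q.sliceR b) ∘ₗ Q.sliceR₂ t := by
  induction t using TensorProduct.induction_on with
  | zero => simp
  | add s s' hs hs' => simp only [map_add, LinearMap.comp_add, hs, hs']
  | tmul e e' =>
    ext x x'
    simp [MultiplierAlgebra.inr_left, sliceR₂_tmul, sliceR_mul]

lemma exists_sliceR_eq (x : A) : x ∈ Submodule.span ℂ {a | ∃ b y, a = Q.sliceR b y} := by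
  obtain ⟨t, rfl⟩ := Q.exists_sliceSnd_φ_T₁ x
  induction t using TensorProduct.induction_on with
  | zero => simp
  | add s t hs ht =>
    simp only [map_add]
    exact add_mem hs ht
  | tmul c d => exact Submodule.subset_span ⟨Q.fourier d, c, (Q.sliceR_fourier d c).symm⟩

/-- The values of u(e ⊗ e') are those of u at tensors of right slices, and these slices span A. -/
lemma dual_tensor_eq_of_mul {u v : Q.Dual ⊗[ℂ] Q.Dual} (h : ∀ s, u * s = v * s) : u = v := by
  apply Q.ev₂_injective
  ext x x'
  simp only [TensorProduct.AlgebraTensorModule.curry_apply, LinearMap.restrictScalars_self,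
    TensorProduct.curry_apply]
  induction Q.exists_sliceR_eq x using Submodule.span_induction with
  | zero => simp
  | add a b _ _ ha hb => simp only [TensorProduct.add_tmul, map_add, ha, hb]
  | smul r a _ ha => simp only [← TensorProduct.smul_tmul', map_smul, ha]
  | mem a hm =>
    obtain ⟨e, x, rfl⟩ := hm
    induction Q.exists_sliceR_eq x' using Submodule.span_induction with
    | zero => simp
    | add a b _ _ ha hb => simp only [TensorProduct.tmul_add, map_add, ha, hb]
    | smul r a _ ha => simp only [TensorProduct.tmul_smul, map_smul, ha]
    | mem a hm =>
      obtain ⟨e', x', rfl⟩ := hm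
      rw [← TensorProduct.map_tmul, ← sliceR₂_tmul, ← LinearMap.comp_apply, ← LinearMap.comp_apply,
        ← ev₂_mul, ← ev₂_mul, h]

/-! ### The coproduct of the dual -/

/-- With y = φ(· q) and e = φ(· c), `sliceR_fourier_mul` replaces (ι ⊗ e)Δ(x)q by ∑ φ(xdᵢ)pᵢ. A
second use, with pᵢ and e', frees x', leaving a sum of products φ(xd)φ(x'd'). -/
lemma exists_ev₂_eq_sliceR₂ (y : Q.Dual) (t : Q.Dual ⊗[ℂ] Q.Dual) :
    ∃ w, Q.ev₂ w = Q.ev y ∘ₗ mulOp ∘ₗ Q.sliceR₂ t := by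
  induction t using TensorProduct.induction_on with
  | zero => exact ⟨0, by simp⟩
  | add s t hs ht =>
    obtain ⟨v, hv⟩ := hs
    obtain ⟨w, hw⟩ := ht
    exact ⟨v + w, by simp only [map_add, LinearMap.comp_add, hv, hw]⟩
  | tmul e e' =>
    have key : ∀ u : A ⊗[ℂ] A, ∃ w, ∀ x x', Q.ev₂ w (x ⊗ₜ[ℂ] x') =
        Q.φ (Q.sliceR e' x' * sliceSnd (Q.φ ∘ₗ mulLeft ℂ x) u) := by
      intro u
      induction u using TensorProduct.induction_on with
      | zero => exact ⟨0, by simp⟩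
      | add s t hs ht =>
        obtain ⟨v, hv⟩ := hs
        obtain ⟨w, hw⟩ := ht
        exact ⟨v + w, fun x x' => by simp only [map_add, LinearMap.add_apply, mul_add, hv, hw]⟩
      | tmul p d =>
        refine ⟨Q.fourier d ⊗ₜ[ℂ] Q.fourier (sliceFst Q.φ (Q.W (p ⊗ₜ[ℂ] Q.density e'))),
          fun x x' => ?_⟩
        have h := sliceFst_sliceSnd Q.φ (Q.φ ∘ₗ mulLeft ℂ x') (Q.W (p ⊗ₜ[ℂ] Q.density e'))
        rw [← sliceR_fourier_mul, fourier_density] at h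
        simp [ev₂_tmul, ev_fourier, mul_smul_comm, h]
    obtain ⟨w, hw⟩ := key (Q.W (Q.density y ⊗ₜ[ℂ] Q.density e))
    refine ⟨w, TensorProduct.ext' fun x x' => ?_⟩
    rw [hw, ← sliceR_fourier_mul, fourier_density, ← mul_assoc, ← ev_fourier, fourier_density]
    simp [sliceR₂_tmul]

/-- The mirror image of `sliceR_fourier_mul`: T₁⁻¹ and right invariance replace W and left
invariance. -/
lemma sliceL_mul_eq {e : Q.Dual} {c : A} (hc : ∀ x, Q.ev e x = Q.ψ (x * c)) (x p : A) :
    Q.sliceL e x * p = sliceFst (Q.ψ ∘ₗ mulLeft ℂ x) (Q.T₁.symm (c ⊗ₜ[ℂ] p)) := by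
  rw [← sliceFst_ψ_Δ_left_T₁, LinearEquiv.apply_symm_apply, Δ_left_tmul, sliceFst_rTensor,
    sliceL_mul, ← sliceFst_apply]
  congr 2
  exact LinearMap.ext hc

lemma exists_ev₂_eq_sliceL₂ (y : Q.Dual) (t : Q.Dual ⊗[ℂ] Q.Dual) :
    ∃ w, Q.ev₂ w = Q.ev y ∘ₗ mulOp ∘ₗ Q.sliceL₂ t := by
  induction t using TensorProduct.induction_on with
  | zero => exact ⟨0, by simp⟩
  | add s t hs ht =>
    obtain ⟨v, hv⟩ := hs
    obtain ⟨w, hw⟩ := ht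
    exact ⟨v + w, by simp only [map_add, LinearMap.comp_add, hv, hw]⟩
  | tmul e e' =>
    obtain ⟨c, hc⟩ := Q.exists_ψ_eq_ev e
    obtain ⟨c', hc'⟩ := Q.exists_ψ_eq_ev e'
    have key : ∀ u : A ⊗[ℂ] A, ∃ w, ∀ x x', Q.ev₂ w (x ⊗ₜ[ℂ] x') =
        Q.φ (Q.sliceL e' x' * sliceFst (Q.ψ ∘ₗ mulLeft ℂ x) u) := by
      intro u
      induction u using TensorProduct.induction_on with
      | zero => exact ⟨0, by simp⟩
      | add s t hs ht =>
        obtain ⟨v, hv⟩ := hs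
        obtain ⟨w, hw⟩ := ht
        exact ⟨v + w, fun x x' => by simp only [map_add, LinearMap.add_apply, mul_add, hv, hw]⟩
      | tmul d p =>
        obtain ⟨f, hf⟩ := Q.exists_φ_eq_ψ d
        obtain ⟨f', hf'⟩ := Q.exists_φ_eq_ψ (sliceSnd Q.φ (Q.T₁.symm (c' ⊗ₜ[ℂ] p)))
        refine ⟨Q.fourier f ⊗ₜ[ℂ] Q.fourier f', fun x x' => ?_⟩
        have h := sliceFst_sliceSnd (Q.ψ ∘ₗ mulLeft ℂ x') Q.φ (Q.T₁.symm (c' ⊗ₜ[ℂ] p))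
        rw [← Q.sliceL_mul_eq hc'] at h
        simp only [LinearMap.comp_apply, LinearMap.mulLeft_apply] at h
        simp [ev₂_tmul, ev_fourier, mul_smul_comm, ← hf, ← hf', h]
    obtain ⟨w, hw⟩ := key (Q.T₁.symm (c ⊗ₜ[ℂ] Q.density y))
    refine ⟨w, TensorProduct.ext' fun x x' => ?_⟩
    rw [hw, ← Q.sliceL_mul_eq hc, ← mul_assoc, ← ev_fourier, fourier_density]
    simp [sliceL₂_tmul]

/-- Any choice of preimages is linear, because `ev₂` is injective. -/
lemma exists_lift_ev₂ (G : Q.Dual ⊗[ℂ] Q.Dual →ₗ[ℂ] (A ⊗[ℂ] A →ₗ[ℂ] ℂ))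
    (hG : ∀ t, ∃ w, Q.ev₂ w = G t) :
    ∃ L : Q.Dual ⊗[ℂ] Q.Dual →ₗ[ℂ] Q.Dual ⊗[ℂ] Q.Dual, ∀ t, Q.ev₂ (L t) = G t := by
  choose L hL using hG
  exact ⟨{ toFun := L
           map_add' := fun s t => Q.ev₂_injective <| by simp only [map_add, hL]
           map_smul' := fun r t => Q.ev₂_injective <| by
            simp only [map_smul, hL, RingHom.id_apply] }, hL⟩

/-- `t ↦ Δ_B(y)t`. -/
noncomputable def comulLeft (y : Q.Dual) : Q.Dual ⊗[ℂ] Q.Dual →ₗ[ℂ] Q.Dual ⊗[ℂ] Q.Dual :=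
  (Q.exists_lift_ev₂ ((LinearMap.compRight ℂ (Q.ev y ∘ₗ mulOp)) ∘ₗ Q.sliceR₂)
    (Q.exists_ev₂_eq_sliceR₂ y)).choose

/-- `t ↦ tΔ_B(y)`. -/
noncomputable def comulRight (y : Q.Dual) : Q.Dual ⊗[ℂ] Q.Dual →ₗ[ℂ] Q.Dual ⊗[ℂ] Q.Dual :=
  (Q.exists_lift_ev₂ ((LinearMap.compRight ℂ (Q.ev y ∘ₗ mulOp)) ∘ₗ Q.sliceL₂)
    (Q.exists_ev₂_eq_sliceL₂ y)).choose

lemma ev₂_comulLeft (y : Q.Dual) (t : Q.Dual ⊗[ℂ] Q.Dual) :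
    Q.ev₂ (Q.comulLeft y t) = Q.ev y ∘ₗ mulOp ∘ₗ Q.sliceR₂ t :=
  (Q.exists_lift_ev₂ ((LinearMap.compRight ℂ (Q.ev y ∘ₗ mulOp)) ∘ₗ Q.sliceR₂)
    (Q.exists_ev₂_eq_sliceR₂ y)).choose_spec t

lemma ev₂_comulRight (y : Q.Dual) (t : Q.Dual ⊗[ℂ] Q.Dual) :
    Q.ev₂ (Q.comulRight y t) = Q.ev y ∘ₗ mulOp ∘ₗ Q.sliceL₂ t :=
  (Q.exists_lift_ev₂ ((LinearMap.compRight ℂ (Q.ev y ∘ₗ mulOp)) ∘ₗ Q.sliceL₂)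
    (Q.exists_ev₂_eq_sliceL₂ y)).choose_spec t

/-- The covered product `ax'₍₁₎x₍₁₎ ⊗ (x₍₂₎ ⊗ x'₍₂₎)`. -/
noncomputable def mulComul (a x x' : A) : A ⊗[ℂ] (A ⊗[ℂ] A) :=
  TensorProduct.assoc ℂ A A A
    (rTensor A (Q.T₂.toLinearMap ∘ₗ (TensorProduct.mk ℂ A A).flip x) (Q.T₂ (a ⊗ₜ[ℂ] x')))

lemma mul_mulOp_sliceR₂ (a x x' : A) (w : Q.Dual ⊗[ℂ] Q.Dual) :
    a * mulOp (Q.sliceR₂ w (x ⊗ₜ[ℂ] x')) = sliceSnd (Q.ev₂ w) (Q.mulComul a x x') := by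
  induction w using TensorProduct.induction_on with
  | zero => simp [sliceSnd]
  | add s t hs ht =>
    simp only [map_add, LinearMap.add_apply, mul_add, hs, ht]
    simp [sliceSnd, LinearMap.lTensor_add]
  | tmul e e' =>
    rw [sliceR₂_tmul, TensorProduct.map_tmul, mulOp_tmul, ← mul_assoc, Q.mul_sliceR e' a x', mulComul]
    generalize Q.T₂ (a ⊗ₜ[ℂ] x') = s
    induction s using TensorProduct.induction_on with
    | zero => simp
    | add s t hs ht => simp only [map_add, add_mul, hs, ht]
    | tmul p q =>
      simp only [LinearMap.lTensor_tmul, TensorProduct.rid_tmul, ← TensorProduct.smul_tmul', map_smul, mul_sliceR,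
        LinearMap.rTensor_tmul, LinearMap.comp_apply, LinearMap.flip_apply,
        TensorProduct.mk_apply, LinearEquiv.coe_coe]
      generalize Q.T₂ (p ⊗ₜ[ℂ] x) = s
      induction s using TensorProduct.induction_on with
      | zero => simp
      | add s t hs ht => simp only [map_add, TensorProduct.add_tmul, smul_add, hs, ht]
      | tmul p' q' => simp [ev₂_tmul, smul_smul, mul_comm]

lemma lTensor_map_mulComul (a x x' : A) (e e' : Q.Dual) :
    lTensor A (TensorProduct.map (Q.sliceR e) (Q.sliceR e')) (Q.mulComul a x x') =
      Q.mulComul a (Q.sliceR e x) (Q.sliceR e' x') := by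
  rw [mulComul, mulComul, T₂_sliceR]
  generalize Q.T₂ (a ⊗ₜ[ℂ] x') = s
  induction s using TensorProduct.induction_on with
  | zero => simp
  | add s t hs ht => simp only [map_add, hs, ht]
  | tmul p q =>
    simp only [LinearMap.lTensor_tmul, LinearMap.rTensor_tmul, LinearMap.comp_apply,
      LinearMap.flip_apply, TensorProduct.mk_apply, LinearEquiv.coe_coe, T₂_sliceR]
    generalize Q.T₂ (p ⊗ₜ[ℂ] x) = s
    induction s using TensorProduct.induction_on with
    | zero => simp
    | add s t hs ht => simp only [map_add, TensorProduct.add_tmul, hs, ht]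
    | tmul p' q' => simp

lemma lTensor_mulOp_mulComul (a x x' : A) :
    lTensor A mulOp (Q.mulComul a x x') = Q.T₂ (a ⊗ₜ[ℂ] (x' * x)) := by
  rw [mulComul, T₂_mul_right]
  generalize Q.T₂ (a ⊗ₜ[ℂ] x') = s
  induction s using TensorProduct.induction_on with
  | zero => simp
  | add s t hs ht => simp only [map_add, hs, ht]
  | tmul p q =>
    simp only [LinearMap.rTensor_tmul, LinearMap.comp_apply, LinearMap.flip_apply,
      TensorProduct.mk_apply, LinearEquiv.coe_coe, Δ_right_tmul]
    generalize Q.T₂ (p ⊗ₜ[ℂ] x) = s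
    induction s using TensorProduct.induction_on with
    | zero => simp
    | add s t hs ht => simp only [map_add, TensorProduct.add_tmul, hs, ht]
    | tmul p' q' => simp

/-- This is Δ(x'x) = Δ(x')Δ(x) with the second leg paired with y; through `mulComul` both sides
become slices of one covered product. It makes Δ_B multiplicative. -/
lemma sliceR_mulOp (y : Q.Dual) (t : Q.Dual ⊗[ℂ] Q.Dual) :
    Q.sliceR y ∘ₗ mulOp ∘ₗ Q.sliceR₂ t = mulOp ∘ₗ Q.sliceR₂ (Q.comulLeft y t) := by
  induction t using TensorProduct.induction_on with
  | zero => simp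
  | add s t hs ht => simp only [map_add, LinearMap.comp_add, hs, ht]
  | tmul e e' =>
    refine TensorProduct.ext' fun x x' => ?_
    apply Q.eq_of_forall_mul
    intro a
    change a * Q.sliceR y (mulOp (Q.sliceR₂ (e ⊗ₜ[ℂ] e') (x ⊗ₜ[ℂ] x'))) =
      a * mulOp (Q.sliceR₂ (Q.comulLeft y (e ⊗ₜ[ℂ] e')) (x ⊗ₜ[ℂ] x'))
    rw [mul_mulOp_sliceR₂, ev₂_comulLeft, sliceR₂_tmul, TensorProduct.map_tmul, mulOp_tmul, mul_sliceR,
      ← sliceSnd_apply, ← lTensor_mulOp_mulComul, ← lTensor_map_mulComul, sliceSnd_lTensor,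
      sliceSnd_lTensor]
    rfl

lemma comulLeft_mul (y : Q.Dual) (s t : Q.Dual ⊗[ℂ] Q.Dual) :
    Q.comulLeft y (s * t) = Q.comulLeft y s * t := by
  apply Q.ev₂_injective
  rw [ev₂_mul, ev₂_comulLeft, ev₂_comulLeft, sliceR₂_mul]
  rfl

lemma comulRight_mul (y : Q.Dual) (s t : Q.Dual ⊗[ℂ] Q.Dual) :
    Q.comulRight y (s * t) = s * Q.comulRight y t := by
  apply Q.ev₂_injective
  rw [ev₂_mul', ev₂_comulRight, ev₂_comulRight, sliceL₂_mul]
  rfl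

/-- Left and right slices commute, which is the compatibility required of a multiplier. -/
lemma mul_comulLeft (y : Q.Dual) (s t : Q.Dual ⊗[ℂ] Q.Dual) :
    s * Q.comulLeft y t = Q.comulRight y s * t := by
  apply Q.ev₂_injective
  rw [ev₂_mul', ev₂_mul, ev₂_comulLeft, ev₂_comulRight, LinearMap.comp_assoc, LinearMap.comp_assoc,
    LinearMap.comp_assoc, LinearMap.comp_assoc, sliceL₂_sliceR₂]

/-- The multiplier `Δ_B(y)`. -/
noncomputable def comulFun (y : Q.Dual) : MultiplierAlgebra (Q.Dual ⊗[ℂ] Q.Dual) :=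
  ⟨(Q.comulLeft y, MulOpposite.op (Q.comulRight y)), Q.comulLeft_mul y, Q.comulRight_mul y,
    Q.mul_comulLeft y⟩

lemma dual_multiplier_ext {m n : MultiplierAlgebra (Q.Dual ⊗[ℂ] Q.Dual)}
    (h : ∀ t, m.left t = n.left t) : m = n := by
  apply Subtype.ext
  apply Prod.ext
  · exact LinearMap.ext h
  · apply MulOpposite.unop_injective
    refine LinearMap.ext fun t => Q.dual_tensor_eq_of_mul fun s => ?_
    change m.right t * s = n.right t * s
    rw [← MultiplierAlgebra.mul_left, ← MultiplierAlgebra.mul_left, h]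

/-- The coproduct of the dual. -/
noncomputable def comul : Q.Dual →ₙₐ[ℂ] MultiplierAlgebra (Q.Dual ⊗[ℂ] Q.Dual) where
  toFun := Q.comulFun
  map_smul' r y := Q.dual_multiplier_ext fun t => Q.ev₂_injective <| by
    change Q.ev₂ (Q.comulLeft (r • y) t) = Q.ev₂ (r • Q.comulLeft y t)
    rw [map_smul, ev₂_comulLeft, ev₂_comulLeft, map_smul, LinearMap.smul_comp]
  map_zero' := Q.dual_multiplier_ext fun t => Q.ev₂_injective <| by
    change Q.ev₂ (Q.comulLeft 0 t) = Q.ev₂ 0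
    rw [ev₂_comulLeft, map_zero, map_zero, LinearMap.zero_comp]
  map_add' y y' := Q.dual_multiplier_ext fun t => Q.ev₂_injective <| by
    change Q.ev₂ (Q.comulLeft (y + y') t) = Q.ev₂ (Q.comulLeft y t + Q.comulLeft y' t)
    rw [map_add, ev₂_comulLeft, ev₂_comulLeft, ev₂_comulLeft, map_add, LinearMap.add_comp]
  map_mul' y y' := Q.dual_multiplier_ext fun t => Q.ev₂_injective <| by
    change Q.ev₂ (Q.comulLeft (y * y') t) = Q.ev₂ (Q.comulLeft y (Q.comulLeft y' t))
    rw [ev₂_comulLeft, ev₂_comulLeft, ← sliceR_mulOp]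
    rfl

lemma isDualComul_comul : Q.IsDualComul Q.comul := by
  intro y e e' x x'
  constructor
  · change Q.ev₂ (Q.comulLeft y _) _ = _
    simp [ev₂_comulLeft, sliceR₂_tmul]
  · change Q.ev₂ (Q.comulRight y _) _ = _
    simp [ev₂_comulRight, sliceL₂_tmul]

lemma eq_comul {D : Q.Dual →ₙₐ[ℂ] MultiplierAlgebra (Q.Dual ⊗[ℂ] Q.Dual)} (h : Q.IsDualComul D) :
    D = Q.comul := by
  ext y
  refine Q.dual_multiplier_ext fun t => ?_
  induction t using TensorProduct.induction_on with
  | zero => simp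
  | add s t hs ht => simp only [map_add, hs, ht]
  | tmul e e' =>
    apply Q.ev₂_injective
    refine TensorProduct.ext' fun x x' => ?_
    rw [(h y e e' x x').1, (Q.isDualComul_comul y e e' x x').1]

/-- The element `y₍₁₎ ⊗ y₍₂₎b` of `B ⊗ B`. -/
lemma exists_comul_mul_inr (y b : Q.Dual) : ∃ s : Q.Dual ⊗[ℂ] Q.Dual,
    MultiplierAlgebra.of s = Q.comul y * MultiplierAlgebra.inr b ∧
    ∀ x x', Q.ev₂ s (x ⊗ₜ[ℂ] x') = Q.ev y (Q.sliceR b x' * x) := by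
  obtain ⟨q, hq⟩ := Q.exists_φ_mul_eq_ev y
  obtain ⟨c, hc⟩ := Q.exists_φ_mul_eq_ev b
  have key : ∀ u : A ⊗[ℂ] A, ∃ s, ∀ x x', Q.ev₂ s (x ⊗ₜ[ℂ] x') =
      Q.φ (sliceSnd (Q.φ ∘ₗ mulRight ℂ x') u * x) := by
    intro u
    induction u using TensorProduct.induction_on with
    | zero => exact ⟨0, by simp⟩
    | add s t hs ht =>
      obtain ⟨v, hv⟩ := hs
      obtain ⟨w, hw⟩ := ht
      exact ⟨v + w, fun x x' => by simp only [map_add, LinearMap.add_apply, add_mul, hv, hw]⟩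
    | tmul p d =>
      obtain ⟨f, hf⟩ := Q.exists_ev_eq_φ_mul p
      obtain ⟨f', hf'⟩ := Q.exists_ev_eq_φ_mul d
      exact ⟨f ⊗ₜ[ℂ] f', fun x x' => by simp [ev₂_tmul, hf, hf', smul_mul_assoc, mul_comm]⟩
  -- For y = φ(q ·), b = φ(c ·) and T₂⁻¹(q ⊗ c) = ∑ pᵢ ⊗ dᵢ, left invariance gives qx'₍₁₎φ(cx'₍₂₎) =
  -- ∑ φ(dᵢx')pᵢ. So s = ∑ φ(pᵢ ·) ⊗ φ(dᵢ ·), in B ⊗ B by modularity.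
  obtain ⟨s, hs⟩ := key (Q.T₂.symm (q ⊗ₜ[ℂ] c))
  have hs' : ∀ x x', Q.ev₂ s (x ⊗ₜ[ℂ] x') = Q.ev y (Q.sliceR b x' * x) := by
    intro x x'
    rw [hs, hq, ← mul_assoc, mul_sliceR, ← sliceSnd_apply, ← sliceSnd_φ_Δ_right,
      LinearEquiv.apply_symm_apply, Δ_right_tmul, sliceSnd_lTensor]
    congr 4
    exact (LinearMap.ext hc).symm
  have h : Q.ev₂ s = Q.ev y ∘ₗ mulOp ∘ₗ lTensor A (Q.sliceR b) :=
    TensorProduct.ext' fun x x' => by simp [hs']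
  refine ⟨s, Q.dual_multiplier_ext fun t => Q.ev₂_injective ?_, hs'⟩
  change Q.ev₂ (s * t) = Q.ev₂ (Q.comulLeft y ((MultiplierAlgebra.inr b).left t))
  rw [ev₂_mul, ev₂_comulLeft, sliceR₂_inr_left, h]
  rfl

/-! ### The commutation relations -/

/-- The Fourier transform as an equivalence. -/
noncomputable def fourierEquiv : A ≃ₗ[ℂ] Q.Dual := LinearEquiv.ofBijective _ Q.fourier_bijective

/-- `F ⊗ ι`. -/
noncomputable def fourierTensor : (A ⊗[ℂ] A) ≃ₗ[ℂ] (Q.Dual ⊗[ℂ] A) :=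
  TensorProduct.congr Q.fourierEquiv (LinearEquiv.refl ℂ A)

lemma fourierTensor_apply (t : A ⊗[ℂ] A) : Q.fourierTensor t = rTensor A Q.fourier t := rfl

/-- `(F ⊗ ι)W(F ⊗ ι)⁻¹`. -/
noncomputable def dualW : (Q.Dual ⊗[ℂ] A) ≃ₗ[ℂ] (Q.Dual ⊗[ℂ] A) :=
  (Q.fourierTensor.symm.trans Q.W).trans Q.fourierTensor

lemma dualW_rTensor (t : A ⊗[ℂ] A) :
    Q.dualW (rTensor A Q.fourier t) = rTensor A Q.fourier (Q.W t) := by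
  simp [dualW, ← fourierTensor_apply]

lemma dualW_symm_rTensor (t : A ⊗[ℂ] A) :
    Q.dualW.symm (rTensor A Q.fourier t) = rTensor A Q.fourier (Q.V t) := by
  rw [LinearEquiv.symm_apply_eq, dualW_rTensor, W, LinearEquiv.symm_apply_apply]

lemma dual_tensor_ext {s t : Q.Dual ⊗[ℂ] A}
    (h : ∀ x, sliceFst (Q.ev.flip x) s = sliceFst (Q.ev.flip x) t) : s = t := by
  refine sub_eq_zero.1 <| tensor_eq_zero_of_rTensor (fun x : A => Q.ev.flip x)
    (fun e he => Q.ev_injective <| LinearMap.ext fun x => by simpa using he x) _ fun x => ?_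
  apply (TensorProduct.lid ℂ A).injective
  rw [← sliceFst_apply, map_sub, h, sub_self, map_zero]

lemma sliceFst_contract (θ : A →ₗ[ℂ] A) (s : Q.Dual ⊗[ℂ] Q.Dual) (t : A ⊗[ℂ] A) (x : A) :
    sliceFst (Q.ev.flip x) (Q.contract θ s t) =
      sliceFst (Q.ev₂ s ∘ₗ (TensorProduct.mk ℂ A A).flip x ∘ₗ θ) t := by
  induction t using TensorProduct.induction_on with
  | zero => simp [contract]
  | add t t' ht ht' =>
    simp only [contract, TensorProduct.tmul_add, map_add] at ht ht' ⊢
    rw [ht, ht']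
  | tmul r r' =>
    rw [sliceFst_tmul]
    induction s using TensorProduct.induction_on with
    | zero => simp [contract]
    | add s s' hs hs' =>
      simp only [contract, TensorProduct.add_tmul, map_add, LinearMap.add_comp,
        LinearMap.add_apply, add_smul] at hs hs' ⊢
      rw [hs, hs']
    | tmul y y' => simp [contract_tmul, ev₂_tmul, smul_smul]

lemma sliceFst_rTensor_fourier_mul (w : A ⊗[ℂ] A) (b : Q.Dual) (a x : A) :
    sliceFst (Q.ev.flip x) (rTensor A Q.fourier w * (b ⊗ₜ[ℂ] a)) =
      sliceFst (Q.φ ∘ₗ mulLeft ℂ (Q.sliceR b x)) (lTensor A (mulRight ℂ a) w) := by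
  induction w using TensorProduct.induction_on with
  | zero => simp
  | add s t hs ht => simp only [map_add, add_mul, hs, ht]
  | tmul p x' => simp [ev_mul, ev_fourier]

/-- A map `F(p) ⊗ x ↦ (F ⊗ ι)(θ(x₍₁₎)p ⊗ x₍₂₎)` has the Sweedler form
`y ⊗ x ↦ ⟨θ(x₍₁₎), y₍₁₎⟩y₍₂₎ ⊗ x₍₂₎`. -/
lemma isSweedlerMap_of_rTensor {θ : A →ₗ[ℂ] A} {G : A ⊗[ℂ] A →ₗ[ℂ] A ⊗[ℂ] A}
    {U : Q.Dual ⊗[ℂ] A →ₗ[ℂ] Q.Dual ⊗[ℂ] A}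
    (hU : ∀ t, U (rTensor A Q.fourier t) = rTensor A Q.fourier (G t))
    (hG : ∀ p x a, lTensor A (mulRight ℂ a) (G (p ⊗ₜ[ℂ] x)) =
      rTensor A (mulRight ℂ p ∘ₗ θ) (Q.T₁ (x ⊗ₜ[ℂ] a))) :
    Q.IsSweedlerMap Q.comul θ U := by
  intro y b x a
  obtain ⟨s, hs, hs'⟩ := Q.exists_comul_mul_inr y b
  refine ⟨s, hs, Q.dual_tensor_ext fun x' => ?_⟩
  obtain ⟨p, rfl⟩ := Q.fourier_surjective y
  -- Evaluated at x' in the B-leg, both sides slice the first leg of T₁(x ⊗ a) by the functional r ↦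
  -- φ((ι ⊗ b)Δ(x')θ(r)p).
  rw [← LinearMap.rTensor_tmul, hU, sliceFst_rTensor_fourier_mul, hG, sliceFst_contract,
    sliceFst_rTensor]
  congr 2
  ext r
  simp [hs', ev_fourier, mul_assoc]

/-- The operators `λ(F(p))x = (φ ⊗ ι)W(p ⊗ x)`. -/
noncomputable def convolution : Q.Dual →ₗ[ℂ] Module.End ℂ A :=
  TensorProduct.curry (sliceFst Q.φ ∘ₗ Q.W.toLinearMap) ∘ₗ Q.fourierEquiv.symm.toLinearMap

lemma convolution_fourier (p x : A) :
    Q.convolution (Q.fourier p) x = sliceFst Q.φ (Q.W (p ⊗ₜ[ℂ] x)) := by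
  have : Q.fourierEquiv.symm (Q.fourier p) = p := Q.fourierEquiv.symm_apply_apply p
  simp [convolution, this]

lemma isConvolutionAction_convolution : Q.IsConvolutionAction Q.antipode Q.convolution := by
  intro b x a
  obtain ⟨p, rfl⟩ := Q.fourier_surjective b
  rw [convolution_fourier, ← LinearMap.mulRight_apply (R := ℂ), ← sliceFst_lTensor,
    lTensor_mulRight_W, sliceFst_rTensor]
  rfl

lemma convMul_rTensor (t : A ⊗[ℂ] A) (x : A) : Q.convMul Q.convolution (rTensor A Q.fourier t) x =
    sliceFst Q.φ (Q.W (lTensor A (mulRight ℂ x) t)) := by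
  induction t using TensorProduct.induction_on with
  | zero => simp
  | add s t hs ht => simp only [map_add, LinearMap.add_apply, hs, ht]
  | tmul p a => simp [convMul_tmul, convolution_fourier]

lemma Δ_left_V (a : A) (u : A ⊗[ℂ] A) :
    (Q.Δ a).left (Q.V u) = Q.V (lTensor A (mulLeft ℂ a) u) := by
  induction u using TensorProduct.induction_on with
  | zero => simp
  | add s t hs ht => simp only [map_add, hs, ht]
  | tmul p x => simp [V_mul_right]

/-- (1 ⊗ a)W = WΔ(a), evaluated at p ⊗ x and sliced by φ; here Δ(a)(p ⊗ x) is V(p ⊗ a)(1 ⊗ x). -/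
lemma mulConv_rTensor (t : A ⊗[ℂ] A) : Q.mulConv Q.convolution (rTensor A Q.fourier t) =
    Q.convMul Q.convolution (rTensor A Q.fourier (Q.V t)) := by
  induction t using TensorProduct.induction_on with
  | zero => simp
  | add s t hs ht => simp only [map_add, hs, ht]
  | tmul p a =>
    ext x
    have h : Q.W (lTensor A (mulRight ℂ x) (Q.V (p ⊗ₜ[ℂ] a))) =
        lTensor A (mulLeft ℂ a) (Q.W (p ⊗ₜ[ℂ] x)) := by
      rw [W, LinearEquiv.symm_apply_eq, ← Δ_left_tmul', ← Δ_left_V, LinearEquiv.apply_symm_apply]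
    rw [convMul_rTensor, h, sliceFst_lTensor, LinearMap.rTensor_tmul, mulConv_tmul,
      convolution_fourier, LinearMap.mulLeft_apply]

lemma mulConv_eq_convMul (t : Q.Dual ⊗[ℂ] A) :
    Q.mulConv Q.convolution t = Q.convMul Q.convolution (Q.dualW.symm t) := by
  obtain ⟨u, rfl⟩ := Q.fourierTensor.surjective t
  rw [fourierTensor_apply, mulConv_rTensor, dualW_symm_rTensor]

end StarAlgebraicQuantumGroup

theorem proposition3p9 {A : Type*} [NonUnitalRing A] [Module ℂ A] [IsScalarTower ℂ A A]
    [SMulCommClass ℂ A A] [StarRing A] [StarModule ℂ A] (Q : StarAlgebraicQuantumGroup A) :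
    Function.Bijective Q.fourier ∧
    (∃! S : A ≃ₗ[ℂ] A, Q.IsAntipode S) ∧
    (∃! D : Q.Dual →ₙₐ[ℂ] MultiplierAlgebra (Q.Dual ⊗[ℂ] Q.Dual), Q.IsDualComul D) ∧
    ∀ (S : A ≃ₗ[ℂ] A) (D : Q.Dual →ₙₐ[ℂ] MultiplierAlgebra (Q.Dual ⊗[ℂ] Q.Dual)),
      Q.IsAntipode S → Q.IsDualComul D →
      ∃ U : (Q.Dual ⊗[ℂ] A) ≃ₗ[ℂ] (Q.Dual ⊗[ℂ] A),
        (∀ t : A ⊗[ℂ] A, U (LinearMap.rTensor A Q.fourier t) =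
          LinearMap.rTensor A Q.fourier (Q.W t)) ∧
        Q.IsSweedlerMap D S.symm.toLinearMap U.toLinearMap ∧
        Q.IsSweedlerMap D LinearMap.id U.symm.toLinearMap ∧
        ∃ L : Q.Dual →ₗ[ℂ] Module.End ℂ A, Q.IsConvolutionAction S L ∧
          ∀ (a : A) (b : Q.Dual),
            Q.mulConv L (b ⊗ₜ[ℂ] a) = Q.convMul L (U.symm (b ⊗ₜ[ℂ] a)) ∧
            Q.convMul L (b ⊗ₜ[ℂ] a) = Q.mulConv L (U (b ⊗ₜ[ℂ] a)) := by
  refine ⟨Q.fourier_bijective, ⟨Q.antipode, Q.isAntipode_antipode, fun S hS => Q.eq_antipode hS⟩,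
    ⟨Q.comul, Q.isDualComul_comul, fun D hD => Q.eq_comul hD⟩, fun S D hS hD => ?_⟩
  obtain rfl := Q.eq_antipode hS
  obtain rfl := Q.eq_comul hD
  refine ⟨Q.dualW, Q.dualW_rTensor,
    Q.isSweedlerMap_of_rTensor (G := Q.W.toLinearMap) Q.dualW_rTensor Q.lTensor_mulRight_W,
    Q.isSweedlerMap_of_rTensor (G := Q.V.toLinearMap) Q.dualW_symm_rTensor
      (fun p x a => Q.V_T₁ a x p),
    Q.convolution, Q.isConvolutionAction_convolution, fun a b => ⟨Q.mulConv_eq_convMul _, ?_⟩⟩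
  -- The second relation is the first one at U(b ⊗ a).
  rw [Q.mulConv_eq_convMul, LinearEquiv.symm_apply_apply]
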